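/- Let $\omega,\alpha\in\mathbb{R}$ with $\omega>\alpha^2$. For complex-valued $v\in H^1(\mathbb{R}_+)$, $\mathbb{R}_+=(0,\infty)$, put \[ S_\omega(v)=\tfrac12\Big[\|v_x\|_{L^2(\mathbb{R}_+)}^2+\omega\|v\|_{L^2(\mathbb{R}_+)}^2+\alpha|v(0)|^2\Big]-\tfrac1{32}\|v\|_{L^6(\mathbb{R}_+)}^6, \] \[ K_\omega(v)=\|v_x\|_{L^2(\mathbb{R}_+)}^2+\omega\|v\|_{L^2(\mathbb{R}_+)}^2+\alpha|v(0)|^2-\tfrac3{16}\|v\|_{L^6(\mathbb{R}_+)}^6, \] where $v(0)$ is the value at $0$ of the representative of $v$ that is continuous on $[0,\infty)$, and consider the variational problem \[ d(\omega)=\inf\{S_\omega(v) : K_\omega(v)=0,\ v\in H^1(\mathbb{R}_+)\setminus\{0\}\}. \] Then the minimizers of this problem are exactly the functions $e^{i\theta}\varphi$ with $\theta\in\mathbb{R}$, where \[ \varphi(x)=2\sqrt[4]{\omega}\,\operatorname{sech}^{1/2}\Big(2\sqrt{\omega}\,|x|+\tanh^{-1}\Big(\frac{-\alpha}{\sqrt{\omega}}\Big)\Big),\qquad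 x>0. \] That is, every minimizer equals $e^{i\theta}\varphi$ (almost everywhere on $\mathbb{R}_+$) for some $\theta\in\mathbb{R}$, and each $e^{i\theta}\varphi$ is a minimizer. -/

import Mathlib

open MeasureTheory Set

noncomputable section

namespace RobinDNLS

/-- Lebesgue measure on the open half line `ℝ₊ = (0, ∞)`. -/
abbrev halfLine : Measure ℝ := (volume : Measure ℝ).restrict (Ioi 0)

/-- `g` is a weak (distributional) derivative of `v` on `(0, ∞)`: for every real test function
`η ∈ C_c^∞((0, ∞))` one has `∫ η' v = - ∫ η g`. Elements of function spaces on the half line are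
represented by functions `ℝ → ℂ`, of which only the a.e.-class on `(0, ∞)` matters. -/
def IsWeakDeriv (v g : ℝ → ℂ) : Prop :=
  ∀ η : ℝ → ℝ, ContDiff ℝ (⊤ : ℕ∞) η → HasCompactSupport η → tsupport η ⊆ Ioi 0 →
    ∫ x, deriv η x • v x ∂halfLine = - ∫ x, η x • g x ∂halfLine

/-- `v ∈ H¹(ℝ₊)`: `v` is (complex valued and) square integrable on `(0, ∞)`, with a weak
derivative that is square integrable on `(0, ∞)`. -/
def MemH1 (v : ℝ → ℂ) : Prop :=
  MemLp v 2 halfLine ∧ ∃ g : ℝ → ℂ, MemLp g 2 halfLine ∧ IsWeakDeriv v g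

open Classical in
/-- The weak derivative `v_x ∈ L²(ℝ₊)` of `v ∈ H¹(ℝ₊)` (unique up to null sets). -/
def weakDeriv (v : ℝ → ℂ) : ℝ → ℂ :=
  if h : ∃ g : ℝ → ℂ, MemLp g 2 halfLine ∧ IsWeakDeriv v g then h.choose else 0

open Classical in
/-- The boundary value `v(0)`: the value at `0` of the representative of `v` that is continuous on
`[0, ∞)`. It is unique if it exists, and it exists for every `v ∈ H¹(ℝ₊)`. -/
def boundaryValue (v : ℝ → ℂ) : ℂ :=
  if h : ∃ u : ℝ → ℂ, ContinuousOn u (Ici 0) ∧ u =ᵐ[halfLine] v then h.choose 0 else 0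

/-- `S_ω(v) = ½ [‖v_x‖²_{L²} + ω ‖v‖²_{L²} + α |v(0)|²] - (1/32) ‖v‖⁶_{L⁶}`. -/
def S (α ω : ℝ) (v : ℝ → ℂ) : ℝ :=
  1 / 2 * ((∫ x, ‖weakDeriv v x‖ ^ 2 ∂halfLine) + ω * (∫ x, ‖v x‖ ^ 2 ∂halfLine)
      + α * ‖boundaryValue v‖ ^ 2)
    - 1 / 32 * ∫ x, ‖v x‖ ^ 6 ∂halfLine

/-- `K_ω(v) = ‖v_x‖²_{L²} + ω ‖v‖²_{L²} + α |v(0)|² - (3/16) ‖v‖⁶_{L⁶}`. -/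
def K (α ω : ℝ) (v : ℝ → ℂ) : ℝ :=
  (∫ x, ‖weakDeriv v x‖ ^ 2 ∂halfLine) + ω * (∫ x, ‖v x‖ ^ 2 ∂halfLine)
      + α * ‖boundaryValue v‖ ^ 2
    - 3 / 16 * ∫ x, ‖v x‖ ^ 6 ∂halfLine

/-- The constraint set `{v ∈ H¹(ℝ₊) \ {0} : K_ω(v) = 0}`. -/
def nehariSet (α ω : ℝ) : Set (ℝ → ℂ) :=
  {v | MemH1 v ∧ ¬ v =ᵐ[halfLine] 0 ∧ K α ω v = 0}

/-- `v` is a minimizer of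
`d(ω) = inf {S_ω(w) : K_ω(w) = 0, w ∈ H¹(ℝ₊) \ {0}}`, i.e. it is admissible and
`S_ω(v) ≤ S_ω(w)` for all admissible `w`. -/
def IsMinimizer (α ω : ℝ) (v : ℝ → ℂ) : Prop :=
  v ∈ nehariSet α ω ∧ IsMinOn (S α ω) (nehariSet α ω) v

/-- The profile `φ(x) = 2 ω^{1/4} sech^{1/2} (2 √ω |x| + artanh (-α / √ω))`. -/
def profile (α ω : ℝ) (x : ℝ) : ℝ :=
  2 * ω ^ (1 / 4 : ℝ) *
    (1 / Real.cosh (2 * √ω * |x| + Real.artanh (-α / √ω))) ^ (1 / 2 : ℝ)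

end RobinDNLS

end

open Filter Topology

/-! On the constraint K = 0 the action equals one sixteenth of `sextic`, the sixth power of the L⁶
norm, so the task is to minimize `sextic` there (`isMinimizer_iff`). Every H¹ function is first
replaced by its absolutely continuous representative (`MemH1.exists_pair`), which turns the weak
derivative and boundary value into concrete data.

The profile is minimal by a calibration argument; no compactness is used. Put s = √(ω - |u|⁴/16). As
long as |u|⁴ ≤ 16ω, the density |u'|² + ω|u|² - |u|⁶/16 = |u'|² + s²|u|² is at least 2s|u||u'|,
hence at least 2|(`calib` ω |u|²)'|. Integrating up to a peak and then out to infinity bounds the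
energy below by 4`calib`(peak) - 2`calib`(|u(0)|²); `boundary_energy_le` handles the boundary term.
The profile φ attains equality throughout, since |φ'| = sφ and φ² is monotone on either side of its
maximum. An arbitrary competitor is scaled to have the same peak as φ, and the inequality 3l - l³ ≤
2 for l ≥ 0 undoes the scaling (`sextic_profile_le`).

Conversely, a minimizer satisfies the Euler–Lagrange identity (`H1Pair.euler_lagrange`). A du
Bois-Reymond argument upgrades it to the equation u'' = ωu - (3/16)|u|⁴u with u'(0) = αu(0)
(`deriv_ae_eq_slope`). Square integrability forces the conserved quantity to vanish
(`first_integral_eq_zero`), which fixes |u(0)| = φ(0). After matching the phase at 0, uniqueness for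
the initial value problem (`eqOn_of_stationary`) identifies u with a rotation of φ. -/

namespace RobinDNLS

/-! ### Absolute continuity and the fundamental theorem of calculus -/

section AbsolutelyContinuous

variable {E F : Type*} [NormedAddCommGroup E] [NormedAddCommGroup F]

/-- A function whose increments are controlled by those of an absolutely continuous function is
absolutely continuous. -/
theorem absolutelyContinuous_of_dist_le {f : ℝ → E} {h : ℝ → F} {a b C : ℝ}
    (hh : AbsolutelyContinuousOnInterval h a b)
    (H : ∀ x ∈ uIcc a b, ∀ y ∈ uIcc a b, dist (f x) (f y) ≤ C * dist (h x) (h y)) :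
    AbsolutelyContinuousOnInterval f a b := by
  unfold AbsolutelyContinuousOnInterval at hh ⊢
  refine squeeze_zero' (Eventually.of_forall fun t => Finset.sum_nonneg fun i _ => dist_nonneg) ?_
    (by simpa using hh.const_mul C)
  filter_upwards [mem_inf_of_right (mem_principal_self _)] with E hE
  rw [Finset.mul_sum]
  refine Finset.sum_le_sum fun i hi => ?_
  exact H _ (hE.1 i hi).1 _ (hE.1 i hi).2

theorem intervalIntegrable_of_locallyIntegrable {f : ℝ → E} (hf : LocallyIntegrable f volume)
    (a b : ℝ) : IntervalIntegrable f volume a b :=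
  (locallyIntegrable_iff.1 hf _ isCompact_uIcc).intervalIntegrable

theorem locallyIntegrable_of_norm_le {f : ℝ → E} {g : ℝ → F} {k : ℝ → ℝ}
    (hg : LocallyIntegrable g volume) (hf : AEStronglyMeasurable f volume) (hk : Continuous k)
    (h : ∀ x, ‖f x‖ ≤ k x * ‖g x‖) : LocallyIntegrable f volume := by
  refine locallyIntegrable_iff.2 fun s hs => ?_
  have h1 : IntegrableOn (fun x => k x * ‖g x‖) s volume :=
    IntegrableOn.continuousOn_mul (g' := fun x => ‖g x‖) hk.continuousOn
    (locallyIntegrable_iff.1 hg s hs).norm hs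
  exact h1.mono' hf.restrict (Eventually.of_forall h)

variable [NormedSpace ℝ E]

/-- Integral functions are absolutely continuous. -/
theorem absolutelyContinuous_integral [CompleteSpace E] {f : ℝ → E} (hf : LocallyIntegrable f volume)
    (a b c : ℝ) : AbsolutelyContinuousOnInterval (fun x => ∫ t in c..x, f t) a b := by
  have hi : ∀ p q, IntervalIntegrable f volume p q := fun p q => intervalIntegrable_of_locallyIntegrable hf p q
  have h1 : AbsolutelyContinuousOnInterval (fun x => ∫ t in a..x, ‖f t‖) a b :=
    (hi a b).norm.absolutelyContinuousOnInterval_intervalIntegral left_mem_uIcc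
  refine absolutelyContinuous_of_dist_le (C := 1) h1 fun x _ y _ => ?_
  rw [dist_eq_norm, intervalIntegral.integral_interval_sub_left (hi _ _) (hi _ _), Real.dist_eq,
    intervalIntegral.integral_interval_sub_left (hi _ _).norm (hi _ _).norm, one_mul]
  exact intervalIntegral.norm_integral_le_abs_integral_norm

/-- The fundamental theorem of calculus for absolutely continuous functions. -/
theorem integral_eq_sub_of_absolutelyContinuous [CompleteSpace E] {f f' : ℝ → E} {a b : ℝ}
    (hf : AbsolutelyContinuousOnInterval f a b) (hf' : LocallyIntegrable f' volume)
    (hd : ∀ᵐ x, x ∈ uIcc a b → HasDerivAt f (f' x) x) :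
    ∫ x in a..b, f' x = f b - f a := by
  have h1 := hf.sub (absolutelyContinuous_integral hf' a b a)
  have h2 : ∀ᵐ x, x ∈ uIcc a b → HasDerivAt (f - fun x => ∫ t in a..x, f' t) 0 x := by
    filter_upwards [hd, _root_.LocallyIntegrable.ae_hasDerivAt_integral hf'] with x h3 h4 hx
    simpa using (h3 hx).sub (h4 a)
  obtain ⟨C, hC⟩ := h1.const_of_ae_hasDerivAt_zero h2
  have e1 := hC a left_mem_uIcc
  have e2 := hC b right_mem_uIcc
  simp only [Pi.sub_apply, intervalIntegral.integral_same, sub_zero] at e1 e2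
  rw [e1, ← e2]
  abel

end AbsolutelyContinuous

/-! ### Absolutely continuous representatives of H¹ functions -/

/-- `u` is locally absolutely continuous with derivative `g`, and both are square integrable on the
half line. -/
structure H1Pair (u g : ℝ → ℂ) : Prop where
  memLp : MemLp u 2 halfLine
  memLp_deriv : MemLp g 2 halfLine
  locInt : LocallyIntegrable g volume
  eq_integral : ∀ x, u x = u 0 + ∫ t in (0 : ℝ)..x, g t

namespace H1Pair

variable {u g : ℝ → ℂ}

theorem intervalIntegrable (h : H1Pair u g) (a b : ℝ) : IntervalIntegrable g volume a b :=
  intervalIntegrable_of_locallyIntegrable h.locInt a b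

theorem ac (h : H1Pair u g) (a b : ℝ) : AbsolutelyContinuousOnInterval u a b := by
  refine absolutelyContinuous_of_dist_le (C := 1) (absolutelyContinuous_integral h.locInt a b 0)
    fun x _ y _ => ?_
  rw [h.eq_integral x, h.eq_integral y, dist_add_left, one_mul]

theorem continuous (h : H1Pair u g) : Continuous u := by
  rw [funext h.eq_integral]
  exact continuous_const.add (intervalIntegral.continuous_primitive h.intervalIntegrable 0)

theorem ae_hasDerivAt (h : H1Pair u g) : ∀ᵐ x, HasDerivAt u (g x) x := by
  filter_upwards [_root_.LocallyIntegrable.ae_hasDerivAt_integral h.locInt] with x hx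
  rw [funext h.eq_integral]
  exact (hx 0).const_add _

theorem const_mul (h : H1Pair u g) (z : ℂ) : H1Pair (fun x => z * u x) (fun x => z * g x) where
  memLp := h.memLp.const_mul z
  memLp_deriv := h.memLp_deriv.const_mul z
  locInt := by
    have := h.locInt.smul z
    exact this
  eq_integral x := by
    rw [intervalIntegral.integral_const_mul, h.eq_integral x, mul_add]

theorem add {w k : ℝ → ℂ} (h : H1Pair u g) (h' : H1Pair w k) :
    H1Pair (fun x => u x + w x) (fun x => g x + k x) where
  memLp := h.memLp.add h'.memLp
  memLp_deriv := h.memLp_deriv.add h'.memLp_deriv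
  locInt := h.locInt.add h'.locInt
  eq_integral x := by
    rw [intervalIntegral.integral_add (h.intervalIntegrable _ _) (h'.intervalIntegrable _ _),
      h.eq_integral x, h'.eq_integral x]
    ring

theorem integrable_sq (h : H1Pair u g) : Integrable (fun x => ‖u x‖ ^ 2) halfLine :=
  h.memLp.integrable_norm_pow (p := 2) (by norm_num)

theorem integrable_deriv_sq (h : H1Pair u g) : Integrable (fun x => ‖g x‖ ^ 2) halfLine :=
  h.memLp_deriv.integrable_norm_pow (p := 2) (by norm_num)

theorem integrable_inner {f k : ℝ → ℂ} (hf : MemLp f 2 halfLine) (hk : MemLp k 2 halfLine) :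
    Integrable (fun x => inner ℝ (f x) (k x)) halfLine := by
  have := MeasureTheory.L2.integrable_inner (𝕜 := ℝ) (hf.toLp f) (hk.toLp k)
  refine this.congr ?_
  filter_upwards [hf.coeFn_toLp, hk.coeFn_toLp] with x h1 h2
  rw [h1, h2]

theorem normSq_ac (h : H1Pair u g) (a b : ℝ) :
    AbsolutelyContinuousOnInterval (fun x => ‖u x‖ ^ 2) a b := by
  obtain ⟨C, hC⟩ := (h.ac a b).exists_bound
  refine absolutelyContinuous_of_dist_le (C := 2 * C) (h.ac a b) fun x hx y hy => ?_
  have h1 := abs_norm_sub_norm_le (u x) (u y)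
  rw [Real.dist_eq, dist_eq_norm, sq_sub_sq, abs_mul, abs_of_nonneg (by positivity)]
  have h2 := hC x hx
  have h3 := hC y hy
  exact mul_le_mul (by linarith) h1 (abs_nonneg _) (by linarith [norm_nonneg (u x)])

theorem ae_hasDerivAt_normSq (h : H1Pair u g) :
    ∀ᵐ x, HasDerivAt (fun x => ‖u x‖ ^ 2) (2 * inner ℝ (u x) (g x)) x := by
  filter_upwards [h.ae_hasDerivAt] with x hx using hx.norm_sq

theorem locallyIntegrable_inner (h : H1Pair u g) :
    LocallyIntegrable (fun x => inner ℝ (u x) (g x)) volume := by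
  refine locallyIntegrable_of_norm_le h.locInt ?_ h.continuous.norm
    fun x => norm_inner_le_norm _ _
  exact h.continuous.aestronglyMeasurable.inner h.locInt.aestronglyMeasurable

theorem normSq_eq_integral (h : H1Pair u g) (a b : ℝ) :
    ∫ x in a..b, 2 * inner ℝ (u x) (g x) = ‖u b‖ ^ 2 - ‖u a‖ ^ 2 :=
  integral_eq_sub_of_absolutelyContinuous (h.normSq_ac a b)
    (h.locallyIntegrable_inner.smul (2 : ℝ))
    (h.ae_hasDerivAt_normSq.mono fun _ hx _ => hx)

/-- The derivative 2⟨u, g⟩ of |u|² is integrable, so |u|² has a limit at infinity; since |u|² is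
itself integrable on a set of infinite measure, that limit is 0. -/
theorem tendsto_normSq (h : H1Pair u g) : Tendsto (fun x => ‖u x‖ ^ 2) atTop (𝓝 0) := by
  have hi := (integrable_inner h.memLp h.memLp_deriv).const_mul 2
  have h1 := (intervalIntegral_tendsto_integral_Ioi 0 hi tendsto_id).const_add (‖u 0‖ ^ 2)
  simp only [id, h.normSq_eq_integral, add_sub_cancel] at h1
  have h2 : IntegrableAtFilter (fun x => ‖u x‖ ^ 2) atTop volume :=
    ⟨Ioi 0, Ioi_mem_atTop _, h.integrable_sq⟩
  have h3 := h2.eq_zero_of_tendsto ?_ h1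
  · rwa [h3] at h1
  · intro s hs
    obtain ⟨b, hb⟩ := mem_atTop_sets.1 hs
    exact eq_top_mono (measure_mono (fun x hx => hb x hx : Ici b ⊆ s)) Real.volume_Ici

/-- Decay at infinity confines the search to a compact interval once |u|² is positive somewhere. The
maximum point is later the turning point of the calibration estimate. -/
theorem exists_isMaxOn (h : H1Pair u g) :
    ∃ x ∈ Ici (0 : ℝ), IsMaxOn (fun x => ‖u x‖ ^ 2) (Ici 0) x := by
  by_cases h0 : ∀ x ∈ Ici (0 : ℝ), ‖u x‖ ^ 2 = 0
  · exact ⟨0, self_mem_Ici, fun x hx => by simp only [mem_ofPred_eq]; rw [h0 x hx, h0 0 self_mem_Ici]⟩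
  push Not at h0
  obtain ⟨y, hy, hy0⟩ := h0
  have hpos : 0 < ‖u y‖ ^ 2 := lt_of_le_of_ne (by positivity) hy0.symm
  refine (h.continuous.norm.pow 2).continuousOn.exists_isMaxOn' isClosed_Ici hy ?_
  rw [cocompact_eq_atBot_atTop, inf_comm, inf_sup_left, eventually_sup, inf_comm]
  refine ⟨?_, (h.tendsto_normSq.eventually (Iio_mem_nhds hpos)).filter_mono inf_le_right |>.mono
    fun x hx => le_of_lt hx⟩
  have : (atBot : Filter ℝ) ⊓ 𝓟 (Ici 0) = ⊥ := by
    rw [inf_principal_eq_bot]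
    filter_upwards [Iio_mem_atBot (0 : ℝ)] with x hx using fun h => (not_le.2 (mem_Iio.1 hx)) h
  rw [this]
  exact eventually_bot

theorem exists_bound (h : H1Pair u g) : ∃ C, 0 ≤ C ∧ ∀ x, 0 ≤ x → ‖u x‖ ≤ C := by
  obtain ⟨y, _, hm⟩ := h.exists_isMaxOn
  exact ⟨‖u y‖, norm_nonneg _, fun x hx => le_of_sq_le_sq (hm hx) (norm_nonneg _)⟩

theorem integrable_pow_six (h : H1Pair u g) : Integrable (fun x => ‖u x‖ ^ 6) halfLine := by
  obtain ⟨C, hC0, hC⟩ := h.exists_bound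
  have := h.integrable_sq.bdd_mul (c := C ^ 4) (f := fun x => ‖u x‖ ^ 4)
    (h.continuous.norm.pow 4).aestronglyMeasurable (by
      filter_upwards [ae_restrict_mem measurableSet_Ioi] with x hx
      rw [Real.norm_of_nonneg (by positivity)]
      gcongr
      exact hC x (le_of_lt hx))
  exact this.congr (Eventually.of_forall fun x => by simp only; ring)

end H1Pair
-- Weak derivatives on the half line
theorem setIntegral_Ioi_eq_intervalIntegral {E : Type*} [NormedAddCommGroup E] [NormedSpace ℝ E]
    {f : ℝ → E} {R : ℝ} (hR : 0 ≤ R) (hf : ∀ x, R < x → f x = 0) :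
    ∫ x, f x ∂halfLine = ∫ x in (0 : ℝ)..R, f x := by
  rw [intervalIntegral.integral_of_le hR]
  refine setIntegral_eq_of_subset_of_forall_sdiff_eq_zero measurableSet_Ioi Ioc_subset_Ioi_self ?_
  rintro x ⟨hx, hx'⟩
  exact hf x (not_le.1 fun h => hx' ⟨hx, h⟩)

/-- Integration by parts of a `C¹` function against a locally absolutely continuous one. -/
theorem integral_smul_add_smul {E : Type*} [NormedAddCommGroup E] [NormedSpace ℝ E]
    [CompleteSpace E] {h k : ℝ → ℝ} {u g : ℝ → E} (hk : Continuous k)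
    (hh : ∀ x, HasDerivAt h (k x) x) (hg : LocallyIntegrable g volume)
    (hu : ∀ x, u x = u 0 + ∫ t in (0 : ℝ)..x, g t) (a b : ℝ) :
    ∫ x in a..b, k x • u x + h x • g x = h b • u b - h a • u a := by
  have hac : AbsolutelyContinuousOnInterval u a b := by
    refine absolutelyContinuous_of_dist_le (C := 1) (absolutelyContinuous_integral hg a b 0)
      fun x _ y _ => ?_
    rw [hu x, hu y, dist_add_left, one_mul]
  have huc : Continuous u := by
    rw [funext hu]
    exact continuous_const.add (intervalIntegral.continuous_primitive
      (intervalIntegrable_of_locallyIntegrable hg) 0)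
  have hc : Continuous h := continuous_iff_continuousAt.2 fun x => (hh x).continuousAt
  have hh1 : ContDiff ℝ 1 h := by
    rw [contDiff_one_iff_deriv]
    exact ⟨fun x => (hh x).differentiableAt, by rwa [funext fun x => (hh x).deriv]⟩
  refine integral_eq_sub_of_absolutelyContinuous
    (hh1.contDiffOn.absolutelyContinuousOnInterval.smul hac) ?_ ?_
  · refine (hk.smul huc).locallyIntegrable.add ?_
    exact locallyIntegrable_of_norm_le hg (hc.aestronglyMeasurable.smul hg.aestronglyMeasurable)
      hc.norm fun x => (norm_smul_le _ _)
  · filter_upwards [_root_.LocallyIntegrable.ae_hasDerivAt_integral hg] with x hx _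
    have h1 : HasDerivAt u (g x) x := by
      rw [funext hu]
      exact (hx 0).const_add _
    have := (hh x).smul h1
    rwa [add_comm] at this

theorem exists_support_bounds {η : ℝ → ℝ} (hc : HasCompactSupport η) (hs : tsupport η ⊆ Ioi 0) :
    ∃ ε R, 0 < ε ∧ ε < R ∧ tsupport η ⊆ Icc ε R := by
  rcases (tsupport η).eq_empty_or_nonempty with h | h
  · exact ⟨1, 2, by norm_num, by norm_num, by simp [h]⟩
  · obtain ⟨a, ha, hmin⟩ := hc.isCompact.exists_isLeast h
    obtain ⟨b, hb, hmax⟩ := hc.isCompact.exists_isGreatest h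
    exact ⟨a, b + 1, hs ha, by linarith [hmin hb], fun x hx => ⟨hmin hx, by linarith [hmax hx]⟩⟩

theorem integral_deriv_smul_primitive {η : ℝ → ℝ} (hη : ContDiff ℝ (⊤ : ℕ∞) η)
    (hc : HasCompactSupport η) (hs : tsupport η ⊆ Ioi 0) {u g : ℝ → ℂ}
    (hg : LocallyIntegrable g volume) (hu : ∀ x, u x = u 0 + ∫ t in (0 : ℝ)..x, g t) :
    ∫ x, deriv η x • u x ∂halfLine = - ∫ x, η x • g x ∂halfLine := by
  obtain ⟨ε, R, hε, hεR, hsub⟩ := exists_support_bounds hc hs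
  have z0 : ∀ x, x ∉ tsupport η → η x = 0 := fun x hx => image_eq_zero_of_notMem_tsupport hx
  have z1 : ∀ x, x ∉ tsupport η → deriv η x = 0 := fun x hx =>
    image_eq_zero_of_notMem_tsupport fun h => hx (tsupport_deriv_subset h)
  have hout : ∀ x, R < x → x ∉ tsupport η := fun x hx h => absurd (hsub h).2 (not_le.2 hx)
  have hR : 0 ≤ R := by linarith
  have huc : Continuous u := by
    rw [funext hu]
    exact continuous_const.add (intervalIntegral.continuous_primitive
      (intervalIntegrable_of_locallyIntegrable hg) 0)
  have hdc : Continuous (deriv η) := hη.continuous_deriv (by simp)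
  have h0 : η 0 = 0 := z0 0 fun h => absurd (hsub h).1 (not_le.2 hε)
  have hηR : η (R + 1) = 0 := z0 _ (hout _ (by linarith))
  have key := integral_smul_add_smul hdc
    (fun x => (hη.differentiable (by simp) x).hasDerivAt) hg hu 0 (R + 1)
  rw [h0, hηR, zero_smul, zero_smul, sub_zero, intervalIntegral.integral_add] at key
  · rw [setIntegral_Ioi_eq_intervalIntegral (R := R + 1) (by linarith),
      setIntegral_Ioi_eq_intervalIntegral (R := R + 1) (by linarith)]
    · exact eq_neg_of_add_eq_zero_left key
    · intro x hx
      rw [z0 x (hout x (by linarith)), zero_smul]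
    · intro x hx
      rw [z1 x (hout x (by linarith)), zero_smul]
  · exact (hdc.smul huc).intervalIntegrable _ _
  · refine intervalIntegrable_of_locallyIntegrable (f := fun x => η x • g x)
      (locallyIntegrable_of_norm_le hg
        (hη.continuous.aestronglyMeasurable.smul hg.aestronglyMeasurable)
        hη.continuous.norm fun x => (norm_smul_le _ _)) _ _

theorem ae_eq_zero_of_forall_test {f : ℝ → ℂ} (hf : LocallyIntegrable f halfLine)
    (h : ∀ η : ℝ → ℝ, ContDiff ℝ (⊤ : ℕ∞) η → HasCompactSupport η → tsupport η ⊆ Ioi 0 →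
      ∫ x, η x • f x ∂halfLine = 0) : ∀ᵐ x ∂halfLine, f x = 0 := by
  filter_upwards [isOpen_Ioi.ae_eq_zero_of_integral_contDiff_smul_eq_zero
    (hf.locallyIntegrableOn (Ioi 0)) h, ae_restrict_mem measurableSet_Ioi] with x hx hx'
    using hx hx'

theorem memLp_two_locallyIntegrable {f : ℝ → ℂ} (hf : MemLp f 2 halfLine) :
    LocallyIntegrable f halfLine := hf.locallyIntegrable (by norm_num)

/-- A locally integrable function on the half line with zero weak derivative is constant. -/
theorem exists_ae_eq_const {d : ℝ → ℂ} (hd : LocallyIntegrable d halfLine)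
    (h : ∀ η : ℝ → ℝ, ContDiff ℝ (⊤ : ℕ∞) η → HasCompactSupport η → tsupport η ⊆ Ioi 0 →
      ∫ x, deriv η x • d x ∂halfLine = 0) : ∃ c : ℂ, ∀ᵐ x ∂halfLine, d x = c := by
  -- A fixed test function of mass one; outer radius 1/2 around 1 keeps its support inside (0, ∞).
  let b : ContDiffBump (1 : ℝ) := ⟨1 / 4, 1 / 2, by norm_num, by norm_num⟩
  let ψ₀ : ℝ → ℝ := b.normed volume
  have hψ₀ : ContDiff ℝ (⊤ : ℕ∞) ψ₀ := b.contDiff_normed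
  have hψ₀c : HasCompactSupport ψ₀ := b.hasCompactSupport_normed
  have hψ₀s : tsupport ψ₀ ⊆ Ioi 0 := by
    rw [b.tsupport_normed_eq, Real.closedBall_eq_Icc]
    intro x hx
    have : (1 : ℝ) - 1 / 2 ≤ x := hx.1
    exact mem_Ioi.2 (by linarith)
  have hψ₀i : ∫ x, ψ₀ x = 1 := b.integral_normed
  refine ⟨∫ x, ψ₀ x • d x ∂halfLine, ?_⟩
  set c : ℂ := ∫ x, ψ₀ x • d x ∂halfLine with hcdef
  suffices ∀ᵐ x ∂halfLine, d x - c = 0 from this.mono fun x hx => sub_eq_zero.1 hx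
  refine ae_eq_zero_of_forall_test (hd.sub continuous_const.locallyIntegrable) fun ψ hψ hψc hψs => ?_
  set m : ℝ := ∫ x, ψ x with hm
  -- Subtracting the mass of ψ leaves a function of mean zero, so its primitive again has compact
  -- support in (0, ∞) and is an admissible test function.
  let k : ℝ → ℝ := fun x => ψ x - m * ψ₀ x
  have hk : ContDiff ℝ (⊤ : ℕ∞) k := hψ.sub (contDiff_const.mul hψ₀)
  let η : ℝ → ℝ := fun x => ∫ t in (0 : ℝ)..x, k t
  have hη' : ∀ x, HasDerivAt η (k x) x := fun x =>
    intervalIntegral.integral_hasDerivAt_right (hk.continuous.intervalIntegrable _ _)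
      hk.continuous.stronglyMeasurable.stronglyMeasurableAtFilter hk.continuous.continuousAt
  have hdη : deriv η = k := funext fun x => (hη' x).deriv
  have hη : ContDiff ℝ (⊤ : ℕ∞) η := by
    rw [contDiff_infty_iff_deriv, hdη]
    exact ⟨fun x => (hη' x).differentiableAt, hk⟩
  obtain ⟨ε₁, R₁, hε₁, hR₁, hs₁⟩ := exists_support_bounds hψc hψs
  obtain ⟨ε₀, R₀, hε₀, hR₀, hs₀⟩ := exists_support_bounds hψ₀c hψ₀s
  have zψ : ∀ x, x < ε₁ ∨ R₁ < x → ψ x = 0 := fun x hx =>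
    image_eq_zero_of_notMem_tsupport fun h => by
      have := hs₁ h
      rcases hx with hx | hx <;> linarith [this.1, this.2]
  have zψ₀ : ∀ x, x < ε₀ ∨ R₀ < x → ψ₀ x = 0 := fun x hx =>
    image_eq_zero_of_notMem_tsupport fun h => by
      have := hs₀ h
      rcases hx with hx | hx <;> linarith [this.1, this.2]
  have zk : ∀ x, x < min ε₀ ε₁ ∨ max R₀ R₁ < x → k x = 0 := fun x hx => by
    have h1 := zψ x (hx.imp (fun h => h.trans_le (min_le_right _ _))
      (fun h => (le_max_right _ _).trans_lt h))
    have h2 := zψ₀ x (hx.imp (fun h => h.trans_le (min_le_left _ _))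
      (fun h => (le_max_left _ _).trans_lt h))
    simp [k, h1, h2]
  have hεpos : 0 < min ε₀ ε₁ := lt_min hε₀ hε₁
  have hRpos : 0 < max R₀ R₁ := lt_max_of_lt_left (hε₀.trans hR₀)
  have ek : ∫ x, k x = 0 := by
    simp only [k]
    rw [integral_sub (hψ.continuous.integrable_of_hasCompactSupport hψc)
      ((hψ₀.continuous.integrable_of_hasCompactSupport hψ₀c).const_mul m),
      integral_const_mul, hψ₀i, mul_one, sub_self]
  have zη : ∀ x, x < min ε₀ ε₁ ∨ max R₀ R₁ < x → η x = 0 := by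
    rintro x (hx | hx)
    · refine (intervalIntegral.integral_congr (g := fun _ => (0 : ℝ)) fun t ht => ?_).trans (by simp)
      exact zk t (Or.inl ((ht.2.trans_lt (max_lt hεpos hx))))
    · rw [← ek]
      simp only [η]
      rw [intervalIntegral.integral_of_le (hRpos.trans hx).le]
      refine setIntegral_eq_integral_of_forall_compl_eq_zero fun t ht => zk t ?_
      by_cases h0 : 0 < t
      · exact Or.inr (hx.trans (not_le.1 fun h => ht ⟨h0, h⟩))
      · exact Or.inl ((not_lt.1 h0).trans_lt hεpos)
  have hsη : tsupport η ⊆ Icc (min ε₀ ε₁) (max R₀ R₁) :=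
    closure_minimal (fun x hx => by
      by_contra hcon
      refine hx (zη x ?_)
      by_contra! hcon'
      exact hcon ⟨hcon'.1, hcon'.2⟩) isClosed_Icc
  have hηc : HasCompactSupport η :=
    isCompact_Icc.of_isClosed_subset (isClosed_tsupport _) hsη
  have key := h η hη hηc fun x hx => hεpos.trans_le (hsη hx).1
  rw [hdη] at key
  have i1 : Integrable (fun x => ψ x • d x) halfLine :=
    hd.integrable_smul_left_of_hasCompactSupport hψ.continuous hψc
  have i0 : Integrable (fun x => ψ₀ x • d x) halfLine :=
    hd.integrable_smul_left_of_hasCompactSupport hψ₀.continuous hψ₀c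
  have e1 : ∫ x, k x • d x ∂halfLine = (∫ x, ψ x • d x ∂halfLine) - m • c := by
    have i2 : Integrable (fun x => m • ψ₀ x • d x) halfLine := i0.smul m
    rw [hcdef, ← integral_smul, ← integral_sub i1 i2]
    refine integral_congr_ae (Eventually.of_forall fun x => ?_)
    simp only [k, sub_smul, smul_smul]
  have e2 : ∫ x, ψ x ∂halfLine = m :=
    setIntegral_eq_integral_of_forall_compl_eq_zero fun t ht =>
      zψ t (Or.inl ((not_lt.1 ht).trans_lt hε₁))
  simp only [smul_sub]
  rw [integral_sub i1, integral_smul_const, e2, ← e1, key]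
  exact (hψ.continuous.integrable_of_hasCompactSupport hψc).restrict.smul_const c

theorem IsWeakDeriv.ae_unique {v g₁ g₂ : ℝ → ℂ} (h₁ : IsWeakDeriv v g₁) (h₂ : IsWeakDeriv v g₂)
    (m₁ : MemLp g₁ 2 halfLine) (m₂ : MemLp g₂ 2 halfLine) : g₁ =ᵐ[halfLine] g₂ := by
  have l₁ := memLp_two_locallyIntegrable m₁
  have l₂ := memLp_two_locallyIntegrable m₂
  have := ae_eq_zero_of_forall_test (l₁.sub l₂) fun η hη hc hs => by
    have e := (h₁ η hη hc hs).symm.trans (h₂ η hη hc hs)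
    simp only [Pi.sub_apply, smul_sub]
    rw [integral_sub (l₁.integrable_smul_left_of_hasCompactSupport hη.continuous hc)
      (l₂.integrable_smul_left_of_hasCompactSupport hη.continuous hc), neg_injective e, sub_self]
  exact this.mono fun x hx => sub_eq_zero.1 hx

theorem IsWeakDeriv.congr {v w g : ℝ → ℂ} (h : IsWeakDeriv v g) (hvw : v =ᵐ[halfLine] w) :
    IsWeakDeriv w g := fun η hη hc hs => by
  rw [← h η hη hc hs]
  exact integral_congr_ae (hvw.mono fun x hx => by simp only [hx])

namespace H1Pair

variable {u g v : ℝ → ℂ}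

theorem isWeakDeriv (h : H1Pair u g) : IsWeakDeriv u g := fun _ hη hc hs =>
  integral_deriv_smul_primitive hη hc hs h.locInt h.eq_integral

theorem memH1 (h : H1Pair u g) (hv : v =ᵐ[halfLine] u) : MemH1 v :=
  ⟨h.memLp.ae_eq hv.symm, g, h.memLp_deriv, h.isWeakDeriv.congr hv.symm⟩

theorem weakDeriv_ae_eq (h : H1Pair u g) (hv : v =ᵐ[halfLine] u) :
    weakDeriv v =ᵐ[halfLine] g := by
  have hex := (h.memH1 hv).2
  rw [weakDeriv, dif_pos hex]
  exact hex.choose_spec.2.ae_unique (h.isWeakDeriv.congr hv.symm) hex.choose_spec.1 h.memLp_deriv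

/-- Two representatives continuous on [0, ∞) that agree almost everywhere agree everywhere there, so
the choice in the definition is immaterial. -/
theorem boundaryValue_eq (h : H1Pair u g) (hv : v =ᵐ[halfLine] u) : boundaryValue v = u 0 := by
  have hex : ∃ w : ℝ → ℂ, ContinuousOn w (Ici 0) ∧ w =ᵐ[halfLine] v :=
    ⟨u, h.continuous.continuousOn, hv.symm⟩
  rw [boundaryValue, dif_pos hex]
  have h1 : hex.choose =ᵐ[volume.restrict (Ici 0)] u := by
    rw [← restrict_Ioi_eq_restrict_Ici]
    exact hex.choose_spec.2.trans hv
  exact Measure.eqOn_of_ae_eq h1 hex.choose_spec.1 h.continuous.continuousOn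
    (by rw [interior_Ici, closure_Ioi]) self_mem_Ici

end H1Pair

/-- The difference between v and a primitive of its weak derivative has zero weak derivative, hence
is constant. -/
theorem MemH1.exists_pair {v : ℝ → ℂ} (hv : MemH1 v) : ∃ u g, H1Pair u g ∧ v =ᵐ[halfLine] u := by
  obtain ⟨hv2, g, hg, hw⟩ := hv
  -- The hypotheses say nothing about g on (-∞, 0]; extension by zero makes it locally integrable on
  -- the whole line.
  let k : ℝ → ℂ := (Ioi 0).indicator g
  have hk2 : MemLp k 2 volume := (memLp_indicator_iff_restrict measurableSet_Ioi).2 hg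
  have hkl : LocallyIntegrable k volume := hk2.locallyIntegrable (by norm_num)
  have hkg : k =ᵐ[halfLine] g := indicator_ae_eq_restrict measurableSet_Ioi
  let U : ℝ → ℂ := fun x => ∫ t in (0 : ℝ)..x, k t
  have hUc : Continuous U := intervalIntegral.continuous_primitive
    (intervalIntegrable_of_locallyIntegrable hkl) 0
  have lv := memLp_two_locallyIntegrable hv2
  have lU : LocallyIntegrable U halfLine := hUc.locallyIntegrable
  obtain ⟨c, hc⟩ := exists_ae_eq_const (d := v - U) (lv.sub lU) fun η hη hc hs => by
    have e1 := hw η hη hc hs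
    have e2 := integral_deriv_smul_primitive hη hc hs hkl (u := U) (by simp [U])
    have e3 : ∫ x, η x • k x ∂halfLine = ∫ x, η x • g x ∂halfLine :=
      integral_congr_ae (hkg.mono fun x hx => by simp only [hx])
    have hdc : Continuous (deriv η) := hη.continuous_deriv (by simp)
    simp only [Pi.sub_apply, smul_sub]
    rw [integral_sub (lv.integrable_smul_left_of_hasCompactSupport hdc hc.deriv)
      (lU.integrable_smul_left_of_hasCompactSupport hdc hc.deriv), e1, e2, e3, sub_self]
  have hvu : v =ᵐ[halfLine] fun x => c + U x :=
    hc.mono fun x hx => by rw [← hx]; simp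
  refine ⟨fun x => c + U x, k, ⟨hv2.ae_eq hvu, hg.ae_eq hkg.symm, hkl, fun x => ?_⟩, hvu⟩
  simp [U]

/-! ### The variational problem in terms of representatives -/

/-- The quadratic part of the action. -/
noncomputable def quadForm (α ω : ℝ) (u g : ℝ → ℂ) : ℝ :=
  (∫ x, ‖g x‖ ^ 2 ∂halfLine) + ω * (∫ x, ‖u x‖ ^ 2 ∂halfLine) + α * ‖u 0‖ ^ 2

/-- The sixth power of the `L⁶` norm. -/
noncomputable def sextic (u : ℝ → ℂ) : ℝ := ∫ x, ‖u x‖ ^ 6 ∂halfLine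

namespace H1Pair

variable {u g v : ℝ → ℂ} {α ω : ℝ}

theorem quadForm_eq (h : H1Pair u g) (hv : v =ᵐ[halfLine] u) :
    (∫ x, ‖weakDeriv v x‖ ^ 2 ∂halfLine) + ω * (∫ x, ‖v x‖ ^ 2 ∂halfLine)
      + α * ‖boundaryValue v‖ ^ 2 = quadForm α ω u g := by
  have h1 : ∫ x, ‖weakDeriv v x‖ ^ 2 ∂halfLine = ∫ x, ‖g x‖ ^ 2 ∂halfLine :=
    integral_congr_ae ((h.weakDeriv_ae_eq hv).mono fun x hx => by simp only [hx])
  have h2 : ∫ x, ‖v x‖ ^ 2 ∂halfLine = ∫ x, ‖u x‖ ^ 2 ∂halfLine :=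
    integral_congr_ae (hv.mono fun x hx => by simp only [hx])
  rw [h1, h2, h.boundaryValue_eq hv, quadForm]

theorem sextic_eq (hv : v =ᵐ[halfLine] u) : ∫ x, ‖v x‖ ^ 6 ∂halfLine = sextic u :=
  integral_congr_ae (hv.mono fun x hx => by simp only [hx])

theorem S_eq (h : H1Pair u g) (hv : v =ᵐ[halfLine] u) :
    S α ω v = 1 / 2 * quadForm α ω u g - 1 / 32 * sextic u := by
  rw [S, h.quadForm_eq hv, sextic_eq hv]

theorem K_eq (h : H1Pair u g) (hv : v =ᵐ[halfLine] u) :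
    K α ω v = quadForm α ω u g - 3 / 16 * sextic u := by
  rw [K, h.quadForm_eq hv, sextic_eq hv]

theorem quadForm_const_mul (u g : ℝ → ℂ) (z : ℂ) :
    quadForm α ω (fun x => z * u x) (fun x => z * g x) = ‖z‖ ^ 2 * quadForm α ω u g := by
  simp only [quadForm, norm_mul, mul_pow, integral_const_mul]
  ring

theorem sextic_const_mul (u : ℝ → ℂ) (z : ℂ) :
    sextic (fun x => z * u x) = ‖z‖ ^ 6 * sextic u := by
  simp only [sextic, norm_mul, mul_pow, integral_const_mul]

theorem sextic_nonneg (u : ℝ → ℂ) : 0 ≤ sextic u := integral_nonneg fun x => by positivity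

theorem sextic_pos (h : H1Pair u g) (hu : ¬ u =ᵐ[halfLine] 0) : 0 < sextic u := by
  refine lt_of_le_of_ne (sextic_nonneg u) fun h0 => hu ?_
  have := (integral_eq_zero_iff_of_nonneg (fun x => by positivity) h.integrable_pow_six).1 h0.symm
  filter_upwards [this] with x hx
  simpa using hx

theorem mem_nehariSet_iff (h : H1Pair u g) (hv : v =ᵐ[halfLine] u) :
    v ∈ nehariSet α ω ↔ 0 < sextic u ∧ quadForm α ω u g = 3 / 16 * sextic u := by
  rw [nehariSet, mem_ofPred_eq, h.K_eq hv, sub_eq_zero]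
  refine ⟨fun ⟨_, h0, hk⟩ => ⟨h.sextic_pos fun h1 => h0 (hv.trans h1), hk⟩,
    fun ⟨h0, hk⟩ => ⟨h.memH1 hv, fun h1 => h0.ne' ?_, hk⟩⟩
  have h2 : u =ᵐ[halfLine] 0 := hv.symm.trans h1
  have : sextic u = ∫ x, (0 : ℝ) ∂halfLine :=
    integral_congr_ae (h2.mono fun x hx => by simp only [hx]; simp)
  rw [this, integral_zero]

end H1Pair

/-- Minimizers are the admissible functions of least `L⁶` norm. -/
theorem isMinimizer_iff {α ω : ℝ} {u g v : ℝ → ℂ} (h : H1Pair u g) (hv : v =ᵐ[halfLine] u) :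
    IsMinimizer α ω v ↔ (0 < sextic u ∧ quadForm α ω u g = 3 / 16 * sextic u) ∧
      ∀ w k, H1Pair w k → 0 < sextic w → quadForm α ω w k = 3 / 16 * sextic w →
        sextic u ≤ sextic w := by
  rw [IsMinimizer, h.mem_nehariSet_iff hv]
  -- Under the constraint, S = (3/32 - 1/32) `sextic` = `sextic` / 16, so the two orderings
  -- coincide.
  refine and_congr_right fun ⟨_, h1⟩ => ⟨fun hm w k hw hw0 hwk => ?_, fun hm w hw => ?_⟩
  · have := hm ((hw.mem_nehariSet_iff (EventuallyEq.refl _ w)).2 ⟨hw0, hwk⟩)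
    simp only [mem_ofPred_eq] at this
    rw [h.S_eq hv, hw.S_eq (EventuallyEq.refl _ w), h1, hwk] at this
    linarith
  · obtain ⟨w', k, hwp, hww⟩ := hw.1.exists_pair
    obtain ⟨h3, h4⟩ := (hwp.mem_nehariSet_iff hww).1 hw
    have := hm w' k hwp h3 h4
    simp only [mem_ofPred_eq]
    rw [h.S_eq hv, hwp.S_eq hww, h1, h4]
    linarith

/-! ### The explicit profile -/

/-- The profile without the absolute value, smooth on the whole line. -/
noncomputable def smoothProfile (α ω x : ℝ) : ℝ :=
  √(4 * √ω / Real.cosh (2 * √ω * x + Real.artanh (-α / √ω)))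

/-- The logarithmic derivative of the profile, up to the factor `-√ω`. -/
noncomputable def profileTanh (α ω x : ℝ) : ℝ :=
  Real.tanh (2 * √ω * x + Real.artanh (-α / √ω))

variable {α ω : ℝ}

theorem omega_pos (hω : α ^ 2 < ω) : 0 < ω := (sq_nonneg α).trans_lt hω

theorem profile_eq_smoothProfile (hω : α ^ 2 < ω) {x : ℝ} (hx : 0 ≤ x) :
    profile α ω x = smoothProfile α ω x := by
  have h0 := omega_pos hω
  have hc := Real.cosh_pos (2 * √ω * x + Real.artanh (-α / √ω))
  rw [profile, smoothProfile, abs_of_nonneg hx]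
  symm
  rw [Real.sqrt_eq_iff_mul_self_eq (by positivity) (by positivity), ← Real.sqrt_eq_rpow]
  have h1 : ω ^ (1 / 4 : ℝ) * ω ^ (1 / 4 : ℝ) = √ω := by
    rw [← Real.rpow_add h0, Real.sqrt_eq_rpow]
    norm_num
  have h2 := Real.mul_self_sqrt
    (show 0 ≤ 1 / Real.cosh (2 * √ω * x + Real.artanh (-α / √ω)) by positivity)
  rw [mul_mul_mul_comm, h2, mul_mul_mul_comm, h1]
  ring

theorem smoothProfile_pos (hω : α ^ 2 < ω) (x : ℝ) : 0 < smoothProfile α ω x := by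
  have h0 := Real.sqrt_pos.2 (omega_pos hω)
  have hc := Real.cosh_pos (2 * √ω * x + Real.artanh (-α / √ω))
  exact Real.sqrt_pos.2 (by positivity)

theorem smoothProfile_sq (x : ℝ) : smoothProfile α ω x ^ 2 =
    4 * √ω / Real.cosh (2 * √ω * x + Real.artanh (-α / √ω)) := by
  have hc := Real.cosh_pos (2 * √ω * x + Real.artanh (-α / √ω))
  exact Real.sq_sqrt (by positivity)

theorem smoothProfile_pow_four (hω : α ^ 2 < ω) (x : ℝ) :
    smoothProfile α ω x ^ 4 = 16 * ω * (1 - profileTanh α ω x ^ 2) := by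
  have hc := Real.cosh_pos (2 * √ω * x + Real.artanh (-α / √ω))
  have h1 : smoothProfile α ω x ^ 4 = (smoothProfile α ω x ^ 2) ^ 2 := by ring
  rw [h1, smoothProfile_sq, profileTanh, Real.tanh_eq_sinh_div_cosh, div_pow, div_pow, mul_pow,
    Real.sq_sqrt (omega_pos hω).le, Real.sinh_sq]
  field_simp
  ring

theorem hasDerivAt_smoothProfile (hω : α ^ 2 < ω) (x : ℝ) :
    HasDerivAt (smoothProfile α ω) (-(√ω * profileTanh α ω x) * smoothProfile α ω x) x := by
  have h0 := Real.sqrt_pos.2 (omega_pos hω)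
  have hc := Real.cosh_pos (2 * √ω * x + Real.artanh (-α / √ω))
  have hp := smoothProfile_pos hω x
  have hs := smoothProfile_sq (α := α) (ω := ω) x
  have h1 : HasDerivAt (fun x => 2 * √ω * x + Real.artanh (-α / √ω)) (2 * √ω) x := by
    simpa using ((hasDerivAt_id x).const_mul (2 * √ω)).add_const (Real.artanh (-α / √ω))
  have h2 := ((hasDerivAt_const x (4 * √ω)).div h1.cosh hc.ne').sqrt (by
    simp only [Pi.div_apply]; positivity)
  refine h2.congr_deriv ?_
  change _ / (2 * smoothProfile α ω x) = _
  rw [div_eq_iff (by positivity)]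
  have h3 : -(√ω * profileTanh α ω x) * smoothProfile α ω x * (2 * smoothProfile α ω x)
    = -2 * (√ω * profileTanh α ω x) * smoothProfile α ω x ^ 2 := by ring
  rw [h3, hs, profileTanh, Real.tanh_eq_sinh_div_cosh]
  field_simp
  ring

theorem hasDerivAt_profileTanh (x : ℝ) :
    HasDerivAt (profileTanh α ω) (2 * √ω * (1 - profileTanh α ω x ^ 2)) x := by
  have hc := Real.cosh_pos (2 * √ω * x + Real.artanh (-α / √ω))
  have h1 : HasDerivAt (fun x => 2 * √ω * x + Real.artanh (-α / √ω)) (2 * √ω) x := by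
    simpa using ((hasDerivAt_id x).const_mul (2 * √ω)).add_const (Real.artanh (-α / √ω))
  have h2 := h1.sinh.div h1.cosh hc.ne'
  have e : profileTanh α ω = fun x => Real.sinh (2 * √ω * x + Real.artanh (-α / √ω)) /
      Real.cosh (2 * √ω * x + Real.artanh (-α / √ω)) :=
    funext fun x => Real.tanh_eq_sinh_div_cosh _
  rw [e]
  refine h2.congr_deriv ?_
  field_simp

/-- This is the stationary equation φ'' = ωφ - (3/16)φ⁵. With t = `profileTanh` and t' = 2√ω(1 -
t²), the second derivative is ω(3t² - 2)φ, and φ⁴ = 16ω(1 - t²) eliminates t. -/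
theorem hasDerivAt_deriv_smoothProfile (hω : α ^ 2 < ω) (x : ℝ) :
    HasDerivAt (fun x => -(√ω * profileTanh α ω x) * smoothProfile α ω x)
      (ω * smoothProfile α ω x - 3 / 16 * smoothProfile α ω x ^ 4 * smoothProfile α ω x) x := by
  have h1 := (((hasDerivAt_profileTanh (α := α) (ω := ω) x).const_mul (√ω)).neg).mul
    (hasDerivAt_smoothProfile hω x)
  refine h1.congr_deriv ?_
  have hs := Real.mul_self_sqrt (omega_pos hω).le
  rw [smoothProfile_pow_four hω]
  simp only [Pi.neg_apply]
  linear_combination (smoothProfile α ω x * (3 * profileTanh α ω x ^ 2 - 2)) * hs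

/-- This encodes the Robin condition φ'(0) = αφ(0). The bound |α| < √ω puts -α/√ω in the interval
where tanh inverts artanh. -/
theorem profileTanh_zero (hω : α ^ 2 < ω) : √ω * profileTanh α ω 0 = -α := by
  have h0 := Real.sqrt_pos.2 (omega_pos hω)
  have h1 : |α| < √ω := Real.lt_sqrt_of_sq_lt (by rwa [sq_abs])
  rw [abs_lt] at h1
  rw [profileTanh, mul_zero, zero_add, Real.tanh_artanh]
  · field_simp
  · constructor
    · rw [lt_div_iff₀ h0]; linarith
    · rw [div_lt_iff₀ h0]; linarith

theorem profileTanh_sq_lt_one (x : ℝ) : profileTanh α ω x ^ 2 < 1 := by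
  rw [sq_lt_one_iff_abs_lt_one]
  exact Real.abs_tanh_lt_one _

theorem smoothProfile_zero_sq (hω : α ^ 2 < ω) :
    (smoothProfile α ω 0 ^ 2) ^ 2 = 16 * (ω - α ^ 2) := by
  have h1 := smoothProfile_pow_four hω (α := α) 0
  have h2 := profileTanh_zero hω
  have hs := Real.sq_sqrt (omega_pos hω).le
  have h3 : ω * profileTanh α ω 0 ^ 2 = α ^ 2 := by
    rw [← neg_sq α, ← h2, mul_pow, hs]
  rw [← pow_mul, h1]
  linear_combination -16 * h3

theorem continuous_smoothProfile (hω : α ^ 2 < ω) : Continuous (smoothProfile α ω) :=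
  continuous_iff_continuousAt.2 fun x => (hasDerivAt_smoothProfile hω x).continuousAt

theorem continuous_profileTanh : Continuous (profileTanh α ω) :=
  continuous_iff_continuousAt.2 fun x => (hasDerivAt_profileTanh x).continuousAt

theorem integrable_smoothProfile_sq (hω : α ^ 2 < ω) :
    Integrable (fun x => smoothProfile α ω x ^ 2) halfLine := by
  have h0 := Real.sqrt_pos.2 (omega_pos hω)
  have h1 : Integrable (fun x => Real.exp (-(2 * √ω) * x)) halfLine :=
    integrableOn_exp_mul_Ioi (by linarith) 0
  -- From cosh y ≥ eʸ/2 one gets φ² ≤ 8√ω e⁻ʸ, where y = 2√ω x + artanh(-α/√ω).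
  refine (h1.const_mul (8 * √ω * Real.exp (-Real.artanh (-α / √ω)))).mono'
    ((continuous_smoothProfile hω).pow 2).aestronglyMeasurable (Eventually.of_forall fun x => ?_)
  rw [Real.norm_of_nonneg (by positivity), smoothProfile_sq]
  have hc := Real.cosh_pos (2 * √ω * x + Real.artanh (-α / √ω))
  rw [div_le_iff₀ hc, mul_assoc, mul_assoc, ← mul_assoc (Real.exp _), ← Real.exp_add]
  have h2 : Real.exp (2 * √ω * x + Real.artanh (-α / √ω)) / 2 ≤
      Real.cosh (2 * √ω * x + Real.artanh (-α / √ω)) := by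
    rw [Real.cosh_eq]
    have := Real.exp_pos (-(2 * √ω * x + Real.artanh (-α / √ω)))
    linarith
  have h3 : Real.exp (-Real.artanh (-α / √ω) + -(2 * √ω) * x) *
      Real.exp (2 * √ω * x + Real.artanh (-α / √ω)) = 1 := by
    rw [← Real.exp_add, ← Real.exp_zero]
    congr 1
    ring
  have h4 := mul_le_mul_of_nonneg_left h2
    (Real.exp_pos (-Real.artanh (-α / √ω) + -(2 * √ω) * x)).le
  nlinarith

theorem memLp_two_ofReal {f : ℝ → ℝ} (hf : Continuous f)
    (hi : Integrable (fun x => f x ^ 2) halfLine) : MemLp (fun x => (f x : ℂ)) 2 halfLine := by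
  refine MemLp.ofReal ?_
  exact (memLp_two_iff_integrable_sq hf.aestronglyMeasurable).2 hi

theorem smoothProfile_pair (hω : α ^ 2 < ω) :
    H1Pair (fun x => (smoothProfile α ω x : ℂ))
      (fun x => ((-(√ω * profileTanh α ω x) * smoothProfile α ω x : ℝ) : ℂ)) := by
  have hc := continuous_smoothProfile hω
  have hd : Continuous fun x => -(√ω * profileTanh α ω x) * smoothProfile α ω x :=
    (continuous_const.mul continuous_profileTanh).neg.mul hc
  have hi := integrable_smoothProfile_sq hω
  refine ⟨memLp_two_ofReal hc hi, memLp_two_ofReal hd ?_,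
    (Complex.continuous_ofReal.comp hd).locallyIntegrable, fun x => ?_⟩
  · refine (hi.const_mul ω).mono' (hd.pow 2).aestronglyMeasurable (Eventually.of_forall fun x => ?_)
    have h1 := profileTanh_sq_lt_one (α := α) (ω := ω) x
    rw [Real.norm_of_nonneg (by positivity), mul_pow, neg_sq, mul_pow,
      Real.sq_sqrt (omega_pos hω).le]
    have := omega_pos hω
    gcongr
    nlinarith
  · rw [intervalIntegral.integral_ofReal, intervalIntegral.integral_eq_sub_of_hasDerivAt
      (fun y _ => hasDerivAt_smoothProfile hω y) (hd.intervalIntegrable _ _)]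
    push_cast
    ring

/-- The profile increases up to its maximum point and decreases afterwards. -/
theorem exists_profile_maxPoint (hω : α ^ 2 < ω) : ∃ p, 0 ≤ p ∧
    (∀ x, 0 ≤ x → x < p → profileTanh α ω x ≤ 0) ∧ (∀ x, p ≤ x → 0 ≤ profileTanh α ω x) ∧
    smoothProfile α ω 0 ≤ smoothProfile α ω p ∧
    (α < 0 → smoothProfile α ω p = smoothProfile α ω 0) := by
  have h0 := Real.sqrt_pos.2 (omega_pos hω)
  have hneg : ∀ x, 2 * √ω * x + Real.artanh (-α / √ω) ≤ 0 → profileTanh α ω x ≤ 0 :=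
    fun x hx => by
      rw [profileTanh, Real.tanh_eq_sinh_div_cosh]
      exact div_nonpos_of_nonpos_of_nonneg (Real.sinh_nonpos_iff.2 hx) (Real.cosh_pos _).le
  have hpos : ∀ x, 0 ≤ 2 * √ω * x + Real.artanh (-α / √ω) → 0 ≤ profileTanh α ω x :=
    fun x hx => by
      rw [profileTanh, Real.tanh_eq_sinh_div_cosh]
      exact div_nonneg (Real.sinh_nonneg_iff.2 hx) (Real.cosh_pos _).le
  -- For α ≥ 0 the argument of cosh vanishes at a point of [0, ∞), which is the peak; for α < 0 it
  -- is nonnegative on the half line, so the profile decreases from 0.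
  rcases le_or_gt 0 α with hα | hα
  · have hc : Real.artanh (-α / √ω) ≤ 0 :=
      Real.artanh_nonpos (div_nonpos_of_nonpos_of_nonneg (by linarith) h0.le)
    have hp : 2 * √ω * (-Real.artanh (-α / √ω) / (2 * √ω)) + Real.artanh (-α / √ω) = 0 := by
      field_simp
      ring
    refine ⟨-Real.artanh (-α / √ω) / (2 * √ω), by
      exact div_nonneg (by linarith) (by linarith), fun x _ hx => hneg x ?_, fun x hx => hpos x ?_,
      ?_, fun h => absurd hα (not_le.2 h)⟩
    · rw [← hp]; gcongr
    · rw [← hp]; gcongr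
    · rw [smoothProfile, smoothProfile, hp, Real.cosh_zero, div_one]
      exact Real.sqrt_le_sqrt (div_le_self (by positivity) (Real.one_le_cosh _))
  · have hc : 0 ≤ Real.artanh (-α / √ω) := Real.artanh_nonneg (div_nonneg (by linarith) h0.le)
    exact ⟨0, le_rfl, fun x h1 h2 => absurd h1 (not_le.2 h2), fun x hx => hpos x (by positivity),
      le_rfl, fun _ => rfl⟩

/-! ### Calibration and the lower energy bound -/

/-- The calibration: `2 * calib ω |u|²` has derivative bounded by the energy density of `u`. -/
noncomputable def calib (ω n : ℝ) : ℝ := ∫ s in (0 : ℝ)..n, √(ω - s ^ 2 / 16) / 2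

theorem continuous_calib_integrand : Continuous fun s : ℝ => √(ω - s ^ 2 / 16) / 2 := by fun_prop

theorem hasDerivAt_calib (n : ℝ) : HasDerivAt (calib ω) (√(ω - n ^ 2 / 16) / 2) n :=
  intervalIntegral.integral_hasDerivAt_right
    (continuous_calib_integrand.intervalIntegrable _ _)
    continuous_calib_integrand.stronglyMeasurable.stronglyMeasurableAtFilter
    continuous_calib_integrand.continuousAt

theorem calib_sub (a b : ℝ) : calib ω b - calib ω a = ∫ s in a..b, √(ω - s ^ 2 / 16) / 2 :=
  intervalIntegral.integral_interval_sub_left (continuous_calib_integrand.intervalIntegrable _ _)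
    (continuous_calib_integrand.intervalIntegrable _ _)

/-- A global Lipschitz bound, so that composing `calib` with |u|² preserves absolute continuity. No
range restriction is needed, as the square root of a negative number is 0. -/
theorem dist_calib_le (a b : ℝ) : dist (calib ω a) (calib ω b) ≤ √ω * dist a b := by
  rw [dist_eq_norm, calib_sub, Real.dist_eq]
  refine intervalIntegral.norm_integral_le_of_norm_le_const fun s _ => ?_
  rw [Real.norm_of_nonneg (by positivity)]
  have h1 : √(ω - s ^ 2 / 16) ≤ √ω := Real.sqrt_le_sqrt (by nlinarith [sq_nonneg s])
  linarith [Real.sqrt_nonneg ω]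

theorem calib_zero : calib ω 0 = 0 := intervalIntegral.integral_same

theorem continuous_calib : Continuous (calib ω) :=
  continuous_iff_continuousAt.2 fun n => (hasDerivAt_calib n).continuousAt

/-- Twice the Lagrangian density of the stationary problem. -/
noncomputable def energyDensity (ω : ℝ) (u g : ℝ → ℂ) (x : ℝ) : ℝ :=
  ‖g x‖ ^ 2 + ω * ‖u x‖ ^ 2 - ‖u x‖ ^ 6 / 16

namespace H1Pair

variable {u g : ℝ → ℂ}

theorem integrable_energyDensity (h : H1Pair u g) : Integrable (energyDensity ω u g) halfLine :=
  (h.integrable_deriv_sq.add (h.integrable_sq.const_mul ω)).sub (h.integrable_pow_six.div_const 16)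

theorem integral_quadratic_sub_sextic (h : H1Pair u g) (c : ℝ) :
    ∫ x, (‖g x‖ ^ 2 + ω * ‖u x‖ ^ 2 - c * ‖u x‖ ^ 6) ∂halfLine =
      quadForm α ω u g - α * ‖u 0‖ ^ 2 - c * sextic u := by
  have h1 := h.integrable_deriv_sq
  have h2 := h.integrable_sq.const_mul ω
  have h3 := h.integrable_pow_six.const_mul c
  have h12 : Integrable (fun x => ‖g x‖ ^ 2 + ω * ‖u x‖ ^ 2) halfLine := h1.add h2
  rw [integral_sub h12 h3, integral_add h1 h2, integral_const_mul, integral_const_mul,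
    quadForm, sextic]
  ring

theorem integral_energyDensity (h : H1Pair u g) :
    ∫ x, energyDensity ω u g x ∂halfLine =
      quadForm α ω u g - α * ‖u 0‖ ^ 2 - sextic u / 16 := by
  have := h.integral_quadratic_sub_sextic (α := α) (ω := ω) (1 / 16)
  simp only [energyDensity]
  simp only [one_div_mul_eq_div] at this
  exact this

/-- With s = √(ω - |z|⁴/16) the right side is |w|² + s²|z|², so Cauchy–Schwarz and (|w| - s|z|)² ≥ 0
suffice. For z = u, w = u' the left side is 2|(`calib` ω |u|²)'|. -/
theorem two_mul_calib_deriv_le {z w : ℂ} (hz : (‖z‖ ^ 2) ^ 2 ≤ 16 * ω) :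
    2 * ‖√(ω - (‖z‖ ^ 2) ^ 2 / 16) / 2 * (2 * inner ℝ z w)‖ ≤
      ‖w‖ ^ 2 + ω * ‖z‖ ^ 2 - ‖z‖ ^ 6 / 16 := by
  have h1 := abs_real_inner_le_norm z w
  have h2 : 0 ≤ ω - (‖z‖ ^ 2) ^ 2 / 16 := by linarith
  have h3 := Real.sq_sqrt h2
  rw [norm_mul, norm_mul, Real.norm_of_nonneg (by positivity), Real.norm_two, Real.norm_eq_abs]
  have h4 := mul_le_mul_of_nonneg_left h1 (Real.sqrt_nonneg (ω - (‖z‖ ^ 2) ^ 2 / 16))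
  have h5 := sq_nonneg (‖w‖ - √(ω - (‖z‖ ^ 2) ^ 2 / 16) * ‖z‖)
  have h6 : ‖w‖ ^ 2 + ω * ‖z‖ ^ 2 - ‖z‖ ^ 6 / 16 =
      ‖w‖ ^ 2 + √(ω - (‖z‖ ^ 2) ^ 2 / 16) ^ 2 * ‖z‖ ^ 2 := by
    rw [h3]; ring
  rw [h6]
  nlinarith

theorem energyDensity_nonneg {x : ℝ} (hx : (‖u x‖ ^ 2) ^ 2 ≤ 16 * ω) :
    0 ≤ energyDensity ω u g x :=
  (by positivity : (0 : ℝ) ≤ _).trans (two_mul_calib_deriv_le (w := g x) hx)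

theorem two_mul_abs_calib_sub_le (h : H1Pair u g)
    (hb : ∀ x, 0 ≤ x → (‖u x‖ ^ 2) ^ 2 ≤ 16 * ω) {a b : ℝ} (ha : 0 ≤ a) (hab : a ≤ b) :
    2 * |calib ω (‖u b‖ ^ 2) - calib ω (‖u a‖ ^ 2)| ≤ ∫ x in a..b, energyDensity ω u g x := by
  let d : ℝ → ℝ := fun x => √(ω - (‖u x‖ ^ 2) ^ 2 / 16) / 2 * (2 * inner ℝ (u x) (g x))
  have hcu : Continuous fun x => √(ω - (‖u x‖ ^ 2) ^ 2 / 16) / 2 :=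
    continuous_calib_integrand.comp (h.continuous.norm.pow 2)
  have hd : LocallyIntegrable d volume := by
    refine locallyIntegrable_of_norm_le (k := fun x => √(ω - (‖u x‖ ^ 2) ^ 2 / 16) / 2)
      (h.locallyIntegrable_inner.smul (2 : ℝ)) ?_ hcu fun x => ?_
    · exact hcu.aestronglyMeasurable.mul
        (h.locallyIntegrable_inner.smul (2 : ℝ)).aestronglyMeasurable
    · rw [norm_mul, Real.norm_of_nonneg (by positivity)]
      rfl
  have hac : AbsolutelyContinuousOnInterval (fun x => calib ω (‖u x‖ ^ 2)) a b :=
    absolutelyContinuous_of_dist_le (h.normSq_ac a b) fun x _ y _ => dist_calib_le _ _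
  have key := integral_eq_sub_of_absolutelyContinuous hac hd
    (h.ae_hasDerivAt_normSq.mono fun x hx _ => (hasDerivAt_calib _).comp x hx)
  have hi := (intervalIntegrable_of_locallyIntegrable hd a b).norm.const_mul 2
  have he : IntervalIntegrable (energyDensity ω u g) volume a b := by
    rw [intervalIntegrable_iff_integrableOn_Ioc_of_le hab]
    exact IntegrableOn.mono_set h.integrable_energyDensity
      (Ioc_subset_Ioi_self.trans (Ioi_subset_Ioi ha))
  calc 2 * |calib ω (‖u b‖ ^ 2) - calib ω (‖u a‖ ^ 2)|
      = 2 * ‖∫ x in a..b, d x‖ := by rw [key, Real.norm_eq_abs]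
    _ ≤ 2 * ∫ x in a..b, ‖d x‖ := by
        gcongr
        exact intervalIntegral.norm_integral_le_integral_norm hab
    _ = ∫ x in a..b, 2 * ‖d x‖ := (intervalIntegral.integral_const_mul _ _).symm
    _ ≤ ∫ x in a..b, energyDensity ω u g x :=
        intervalIntegral.integral_mono_on hab hi he fun x hx =>
          two_mul_calib_deriv_le (hb x (ha.trans hx.1))

/-- The energy needed to rise from `|u 0|²` to `|u p|²` and to decay to zero afterwards. -/
theorem le_integral_energyDensity (h : H1Pair u g)
    (hb : ∀ x, 0 ≤ x → (‖u x‖ ^ 2) ^ 2 ≤ 16 * ω) {p : ℝ} (hp : 0 ≤ p) :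
    4 * calib ω (‖u p‖ ^ 2) - 2 * calib ω (‖u 0‖ ^ 2) ≤ ∫ x, energyDensity ω u g x ∂halfLine := by
  have hlim : Tendsto (fun b => 4 * calib ω (‖u p‖ ^ 2) - 2 * calib ω (‖u 0‖ ^ 2)
      - 2 * calib ω (‖u b‖ ^ 2)) atTop
      (𝓝 (4 * calib ω (‖u p‖ ^ 2) - 2 * calib ω (‖u 0‖ ^ 2) - 2 * calib ω 0)) :=
    tendsto_const_nhds.sub
      (((continuous_calib.tendsto 0).comp h.tendsto_normSq).const_mul 2)
  rw [calib_zero, mul_zero, sub_zero] at hlim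
  refine le_of_tendsto hlim ?_
  filter_upwards [Ici_mem_atTop p] with b hpb
  have hpb' : p ≤ b := hpb
  have he : ∀ a b, 0 ≤ a → a ≤ b → IntervalIntegrable (energyDensity ω u g) volume a b :=
    fun a b ha hab => by
      rw [intervalIntegrable_iff_integrableOn_Ioc_of_le hab]
      exact IntegrableOn.mono_set h.integrable_energyDensity
        (Ioc_subset_Ioi_self.trans (Ioi_subset_Ioi ha))
  have h1 := h.two_mul_abs_calib_sub_le hb le_rfl hp
  have h2 := h.two_mul_abs_calib_sub_le hb hp hpb'
  have h3 : ∫ x in (0 : ℝ)..b, energyDensity ω u g x ≤ ∫ x, energyDensity ω u g x ∂halfLine := by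
    rw [intervalIntegral.integral_of_le (hp.trans hpb')]
    refine setIntegral_mono_set h.integrable_energyDensity ?_ Ioc_subset_Ioi_self.eventuallyLE
    filter_upwards [ae_restrict_mem measurableSet_Ioi] with x hx
    exact energyDensity_nonneg (hb x (le_of_lt hx))
  rw [← intervalIntegral.integral_add_adjacent_intervals (he 0 p le_rfl hp) (he p b hp hpb')] at h3
  -- Each leg is bounded by its net change: the rise on [0, p] and the fall on [p, b].
  have h4 := le_abs_self (calib ω (‖u p‖ ^ 2) - calib ω (‖u 0‖ ^ 2))
  have h5 := neg_le_abs (calib ω (‖u b‖ ^ 2) - calib ω (‖u p‖ ^ 2))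
  linarith

end H1Pair

/-- The boundary contribution is smallest at the boundary value of the profile. -/
theorem boundary_energy_le (hω : α ^ 2 < ω) {n B : ℝ} (hn : 0 ≤ n) (hnB : n ≤ B)
    (hα : α < 0 → B = smoothProfile α ω 0 ^ 2) :
    α * smoothProfile α ω 0 ^ 2 - 2 * calib ω (smoothProfile α ω 0 ^ 2) ≤
      α * n - 2 * calib ω n := by
  set A := smoothProfile α ω 0 ^ 2 with hA
  have hA2 : A ^ 2 = 16 * (ω - α ^ 2) := smoothProfile_zero_sq hω
  have hA0 : 0 ≤ A := by positivity
  have hint : ∀ a b, IntervalIntegrable (fun s : ℝ => √(ω - s ^ 2 / 16) / 2) volume a b :=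
    fun a b => continuous_calib_integrand.intervalIntegrable a b
  -- The derivative in n of αn - 2`calib`(n) is α - √(ω - n²/16). It is nonpositive on [0, A] and,
  -- when α ≥ 0, nonnegative beyond A. For α < 0 the cap B = A excludes the second case.
  rcases le_or_gt n A with h | h
  · have h1 : ∫ s in n..A, α / 2 ≤ ∫ s in n..A, √(ω - s ^ 2 / 16) / 2 := by
      refine intervalIntegral.integral_mono_on h (by simp) (hint _ _) fun s hs => ?_
      have : α ≤ √(ω - s ^ 2 / 16) := Real.le_sqrt_of_sq_le (by
        have := pow_le_pow_left₀ (hn.trans hs.1) hs.2 2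
        linarith)
      linarith
    rw [intervalIntegral.integral_const, ← calib_sub, smul_eq_mul] at h1
    linarith
  · have hα0 : 0 ≤ α := by
      by_contra hcon
      have := hα (not_le.1 hcon)
      linarith
    have h1 : ∫ s in A..n, √(ω - s ^ 2 / 16) / 2 ≤ ∫ s in A..n, α / 2 := by
      refine intervalIntegral.integral_mono_on h.le (hint _ _) (by simp) fun s hs => ?_
      have : √(ω - s ^ 2 / 16) ≤ α := Real.sqrt_le_iff.2 ⟨hα0, by
        have := pow_le_pow_left₀ hA0 hs.1 2
        linarith⟩
      linarith
    rw [intervalIntegral.integral_const, ← calib_sub, smul_eq_mul] at h1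
    linarith

/-! ### Constraint and energy of the profile -/

section Profile

/-- The profile as a complex valued function. -/
noncomputable def profileC (α ω x : ℝ) : ℂ := (smoothProfile α ω x : ℂ)

/-- The derivative of the profile, as a complex valued function. -/
noncomputable def profileDerivC (α ω x : ℝ) : ℂ :=
  ((-(√ω * profileTanh α ω x) * smoothProfile α ω x : ℝ) : ℂ)

theorem profileC_pair (hω : α ^ 2 < ω) : H1Pair (profileC α ω) (profileDerivC α ω) :=
  smoothProfile_pair hω

theorem norm_profileC (hω : α ^ 2 < ω) (x : ℝ) : ‖profileC α ω x‖ = smoothProfile α ω x := by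
  rw [profileC, Complex.norm_real, Real.norm_of_nonneg (smoothProfile_pos hω x).le]

theorem norm_profileDerivC_sq (hω : α ^ 2 < ω) (x : ℝ) : ‖profileDerivC α ω x‖ ^ 2 =
    ω * smoothProfile α ω x ^ 2 - smoothProfile α ω x ^ 6 / 16 := by
  have h1 := smoothProfile_pow_four hω (α := α) x
  have hs := Real.sq_sqrt (omega_pos hω).le
  have h2 : smoothProfile α ω x ^ 6 = smoothProfile α ω x ^ 4 * smoothProfile α ω x ^ 2 := by ring
  rw [profileDerivC, Complex.norm_real, Real.norm_eq_abs, sq_abs, mul_pow, neg_sq, mul_pow, hs, h2,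
    h1]
  ring

theorem tendsto_smoothProfile_sq (hω : α ^ 2 < ω) :
    Tendsto (fun x => smoothProfile α ω x ^ 2) atTop (𝓝 0) := by
  simpa only [norm_profileC hω] using (profileC_pair hω).tendsto_normSq

/-- Integrate (φφ')' = φ'² + ωφ² - (3/16)φ⁶ over the half line; the boundary term is -φ(0)φ'(0) =
-αφ(0)². -/
theorem quadForm_profile (hω : α ^ 2 < ω) :
    quadForm α ω (profileC α ω) (profileDerivC α ω) = 3 / 16 * sextic (profileC α ω) := by
  have hp := profileC_pair hω (α := α)
  have h1 := hp.integrable_deriv_sq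
  have h2 := hp.integrable_sq.const_mul ω
  have h3 := hp.integrable_pow_six.const_mul (3 / 16)
  have hder : ∀ x ∈ Ici (0 : ℝ), HasDerivAt
      (fun x => smoothProfile α ω x * (-(√ω * profileTanh α ω x) * smoothProfile α ω x))
      (‖profileDerivC α ω x‖ ^ 2 + ω * ‖profileC α ω x‖ ^ 2 - 3 / 16 * ‖profileC α ω x‖ ^ 6) x := by
    intro x _
    refine ((hasDerivAt_smoothProfile hω x).mul
      (hasDerivAt_deriv_smoothProfile hω x)).congr_deriv ?_
    rw [norm_profileC hω, profileDerivC, Complex.norm_real, Real.norm_eq_abs, sq_abs]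
    ring
  have hlim : Tendsto
      (fun x => smoothProfile α ω x * (-(√ω * profileTanh α ω x) * smoothProfile α ω x))
      atTop (𝓝 0) := by
    refine squeeze_zero_norm (fun x => ?_)
      (by simpa using (tendsto_smoothProfile_sq hω (α := α)).const_mul (√ω))
    have ht : |profileTanh α ω x| ≤ 1 := (Real.abs_tanh_lt_one _).le
    have hpos := smoothProfile_pos hω x (α := α)
    rw [norm_mul, norm_mul, norm_neg, norm_mul, Real.norm_of_nonneg hpos.le,
      Real.norm_of_nonneg (Real.sqrt_nonneg _), Real.norm_eq_abs]
    have := mul_le_mul_of_nonneg_left ht (by positivity : 0 ≤ √ω * smoothProfile α ω x ^ 2)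
    linarith
  have key := integral_Ioi_of_hasDerivAt_of_tendsto' hder ((h1.add h2).sub h3) hlim
  rw [hp.integral_quadratic_sub_sextic (α := α), profileTanh_zero hω, norm_profileC hω] at key
  linear_combination key

/-- The profile saturates the calibration: its density is 2D, where D = ω t² φ² with t =
`profileTanh`, while (`calib` ω φ²)' is D before the peak and -D after it. -/
theorem integral_energyDensity_profile (hω : α ^ 2 < ω) {p : ℝ} (hp : 0 ≤ p)
    (hneg : ∀ x, 0 ≤ x → x < p → profileTanh α ω x ≤ 0)
    (hpos : ∀ x, p ≤ x → 0 ≤ profileTanh α ω x) :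
    ∫ x, energyDensity ω (profileC α ω) (profileDerivC α ω) x ∂halfLine =
      4 * calib ω (smoothProfile α ω p ^ 2) - 2 * calib ω (smoothProfile α ω 0 ^ 2) := by
  have hpr := profileC_pair hω (α := α)
  have hω0 := omega_pos hω
  let D : ℝ → ℝ := fun x => ω * profileTanh α ω x ^ 2 * smoothProfile α ω x ^ 2
  have hDe : ∀ x, energyDensity ω (profileC α ω) (profileDerivC α ω) x = 2 * D x := fun x => by
    have h1 := smoothProfile_pow_four hω (α := α) x
    simp only [energyDensity, norm_profileDerivC_sq hω, norm_profileC hω, D]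
    linear_combination (-(smoothProfile α ω x ^ 2) / 8) * h1
  have hcD : Continuous D := (continuous_const.mul (continuous_profileTanh.pow 2)).mul
    ((continuous_smoothProfile hω).pow 2)
  have hiD : IntegrableOn D (Ioi 0) volume := by
    have h2 := (hpr.integrable_energyDensity (ω := ω)).div_const 2
    simp only [hDe] at h2
    exact h2.congr (Eventually.of_forall fun x => by simp only; ring)
  have hder : ∀ x, HasDerivAt (fun x => calib ω (smoothProfile α ω x ^ 2))
      (-(√ω * |profileTanh α ω x| * (√ω * profileTanh α ω x) * smoothProfile α ω x ^ 2)) x := by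
    intro x
    have h1 := smoothProfile_pow_four hω (α := α) x
    have h2 := (hasDerivAt_calib (ω := ω) (smoothProfile α ω x ^ 2)).comp x
      ((hasDerivAt_smoothProfile hω x).pow 2)
    refine h2.congr_deriv ?_
    have h3 : ω - (smoothProfile α ω x ^ 2) ^ 2 / 16 = ω * profileTanh α ω x ^ 2 := by
      linear_combination (-1 / 16) * h1
    rw [h3, Real.sqrt_mul hω0.le, Real.sqrt_sq_eq_abs]
    push_cast
    ring
  have hs := Real.mul_self_sqrt hω0.le
  have e1 : ∫ x in (0 : ℝ)..p, D x =
      calib ω (smoothProfile α ω p ^ 2) - calib ω (smoothProfile α ω 0 ^ 2) := by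
    refine intervalIntegral.integral_eq_sub_of_hasDerivAt_of_le hp
      (continuous_calib.comp ((continuous_smoothProfile hω).pow 2)).continuousOn
      (fun x hx => (hder x).congr_deriv ?_) (hcD.intervalIntegrable _ _)
    rw [abs_of_nonpos (hneg x hx.1.le hx.2)]
    simp only [D]
    linear_combination profileTanh α ω x ^ 2 * smoothProfile α ω x ^ 2 * hs
  have e2 : ∫ x in Ioi p, -D x = 0 - calib ω (smoothProfile α ω p ^ 2) := by
    refine integral_Ioi_of_hasDerivAt_of_tendsto'
      (f := fun x => calib ω (smoothProfile α ω x ^ 2)) (fun x hx => (hder x).congr_deriv ?_)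
      (hiD.mono_set (Ioi_subset_Ioi hp)).neg ?_
    · rw [abs_of_nonneg (hpos x hx)]
      simp only [D]
      linear_combination -(profileTanh α ω x ^ 2 * smoothProfile α ω x ^ 2) * hs
    · have := (continuous_calib (ω := ω)).tendsto 0
      rw [calib_zero] at this
      exact this.comp (tendsto_smoothProfile_sq hω)
  rw [integral_neg] at e2
  have e3 : ∫ x in Ioi 0, D x = (∫ x in (0 : ℝ)..p, D x) + ∫ x in Ioi p, D x := by
    rw [intervalIntegral.integral_of_le hp, ← Ioc_union_Ioi_eq_Ioi hp]
    exact setIntegral_union (Ioc_disjoint_Ioi le_rfl) measurableSet_Ioi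
      (hiD.mono_set Ioc_subset_Ioi_self) (hiD.mono_set (Ioi_subset_Ioi hp))
  simp only [hDe]
  rw [integral_const_mul, e3, e1]
  linarith

end Profile

/-! ### Minimality of the profile -/

theorem sextic_profile_pos (hω : α ^ 2 < ω) : 0 < sextic (profileC α ω) := by
  refine (profileC_pair hω).sextic_pos fun h => ?_
  obtain ⟨x, hx⟩ : ∃ x, profileC α ω x = 0 := by
    have : (ae halfLine).NeBot := by
      rw [ae_neBot, Ne, Measure.restrict_eq_zero, Real.volume_Ioi]
      exact ENNReal.top_ne_zero
    exact h.exists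
  have := norm_profileC hω x
  rw [hx, norm_zero] at this
  exact (smoothProfile_pos hω x).ne this

/-- The profile has the least `L⁶` norm on the Nehari manifold. -/
theorem sextic_profile_le (hω : α ^ 2 < ω) {u g : ℝ → ℂ} (h : H1Pair u g) (h0 : 0 < sextic u)
    (hK : quadForm α ω u g = 3 / 16 * sextic u) : sextic (profileC α ω) ≤ sextic u := by
  obtain ⟨p, hp, hneg, hpos, hle, hα⟩ := exists_profile_maxPoint hω
  obtain ⟨q, hq, hmax⟩ := h.exists_isMaxOn
  have hmax' : ∀ x, 0 ≤ x → ‖u x‖ ^ 2 ≤ ‖u q‖ ^ 2 := fun x hx => hmax hx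
  have hω0 := omega_pos hω
  set B := smoothProfile α ω p ^ 2 with hB
  have hBpos : 0 < B := pow_pos (smoothProfile_pos hω p) 2
  have hB2 : B ^ 2 ≤ 16 * ω := by
    have := smoothProfile_pow_four hω (α := α) p
    have h2 : B ^ 2 = smoothProfile α ω p ^ 4 := by rw [hB]; ring
    rw [h2, this]
    nlinarith [sq_nonneg (profileTanh α ω p)]
  have huq : 0 < ‖u q‖ ^ 2 := by
    refine lt_of_le_of_ne (by positivity) fun hcon => h0.ne' ?_
    have : sextic u = ∫ x, (0 : ℝ) ∂halfLine := by
      refine setIntegral_congr_fun measurableSet_Ioi fun x hx => ?_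
      have h1 := hmax' x (le_of_lt hx)
      have h2 : ‖u x‖ = 0 := by
        rw [← hcon] at h1
        exact pow_eq_zero_iff two_ne_zero |>.1 (le_antisymm h1 (by positivity))
      simp [h2]
    rw [this, integral_zero]
  -- The competitor is scaled to have the profile's peak, not to stay on the constraint. This
  -- secures |w|⁴ ≤ 16ω, makes the `calib` terms at the two peaks equal, and for α < 0 caps |w(0)|²
  -- by φ(0)².
  set l := B / ‖u q‖ ^ 2 with hl
  have hlpos : 0 < l := div_pos hBpos huq
  let z : ℂ := (√l : ℝ)
  have hz2 : ‖z‖ ^ 2 = l := by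
    rw [Complex.norm_real, Real.norm_of_nonneg (Real.sqrt_nonneg _), Real.sq_sqrt hlpos.le]
  have hz6 : ‖z‖ ^ 6 = l ^ 3 := by rw [← hz2]; ring
  have hw := h.const_mul z
  have hwn : ∀ x, ‖z * u x‖ ^ 2 = l * ‖u x‖ ^ 2 := fun x => by rw [norm_mul, mul_pow, hz2]
  have hwq : l * ‖u q‖ ^ 2 = B := div_mul_cancel₀ _ huq.ne'
  have hwB : ∀ x, 0 ≤ x → ‖z * u x‖ ^ 2 ≤ B := fun x hx => by
    rw [hwn, ← hwq]
    exact mul_le_mul_of_nonneg_left (hmax' x hx) hlpos.le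
  have h1 := hw.le_integral_energyDensity (ω := ω)
    (fun x hx => (pow_le_pow_left₀ (by positivity) (hwB x hx) 2).trans hB2) hq
  have h2 := boundary_energy_le hω (by positivity) (hwB 0 le_rfl) fun hα' => by rw [hB, hα hα']
  have h3 := integral_energyDensity_profile hω hp hneg hpos
  rw [(profileC_pair hω).integral_energyDensity (α := α), quadForm_profile hω, norm_profileC hω]
    at h3
  rw [hw.integral_energyDensity (α := α), H1Pair.quadForm_const_mul, H1Pair.sextic_const_mul, hz2,
    hz6, hK, hwn q, hwq] at h1
  -- The product expands to l³ - 3l + 2. The estimates so far give 2 `sextic` φ ≤ (3l - l³) `sextic`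
  -- u, so the scaling factor is at most 2.
  have h4 : 0 ≤ (l - 1) ^ 2 * (l + 2) := by positivity
  have h5 := mul_nonneg h4 h0.le
  nlinarith

/-! ### First variation on the Nehari manifold -/

theorem norm_add_mul_sq (a b : ℂ) (t : ℝ) :
    ‖a + (t : ℂ) * b‖ ^ 2 = ‖a‖ ^ 2 + 2 * t * inner ℝ a b + t ^ 2 * ‖b‖ ^ 2 := by
  rw [← Complex.real_smul, norm_add_sq_real, real_inner_smul_right, norm_smul, mul_pow,
    Real.norm_eq_abs, sq_abs]
  ring

/-- Convexity of n ↦ n³ at n = |a|², together with |a + tb|² - |a|² ≥ 2t⟨a, b⟩. This tangent bound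
replaces differentiation of the L⁶ term under the integral. -/
theorem norm_pow_six_add_le (a b : ℂ) (t : ℝ) :
    ‖a‖ ^ 6 + 6 * t * (‖a‖ ^ 4 * inner ℝ a b) ≤ ‖a + (t : ℂ) * b‖ ^ 6 := by
  have h := norm_add_mul_sq a b t
  have h1 : ‖a + (t : ℂ) * b‖ ^ 6 = (‖a + (t : ℂ) * b‖ ^ 2) ^ 3 := by ring
  have h2 : ‖a‖ ^ 6 = (‖a‖ ^ 2) ^ 3 := by ring
  have h3 : ‖a‖ ^ 4 = (‖a‖ ^ 2) ^ 2 := by ring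
  rw [h1, h2, h3]
  set A := ‖a + (t : ℂ) * b‖ ^ 2
  set n := ‖a‖ ^ 2
  have hA : 0 ≤ A := by positivity
  have hn : 0 ≤ n := by positivity
  have h4 : 0 ≤ (A - n) ^ 2 * (A + 2 * n) := by positivity
  have h5 : 0 ≤ n ^ 2 * (t ^ 2 * ‖b‖ ^ 2) := by positivity
  have h6 : 2 * t * inner ℝ a b = A - n - t ^ 2 * ‖b‖ ^ 2 := by linarith
  have h7 : 6 * t * (n ^ 2 * inner ℝ a b) = 3 * n ^ 2 * (2 * t * inner ℝ a b) := by ring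
  rw [h7, h6]
  nlinarith

/-- The bilinear form of `quadForm`. -/
noncomputable def bilinForm (α ω : ℝ) (u g w k : ℝ → ℂ) : ℝ :=
  (∫ x, inner ℝ (g x) (k x) ∂halfLine) + ω * (∫ x, inner ℝ (u x) (w x) ∂halfLine)
    + α * inner ℝ (u 0) (w 0)

namespace H1Pair

variable {u g w k : ℝ → ℂ}

theorem integral_norm_add_mul_sq {f e : ℝ → ℂ} (hf : MemLp f 2 halfLine) (he : MemLp e 2 halfLine)
    (t : ℝ) : ∫ x, ‖f x + (t : ℂ) * e x‖ ^ 2 ∂halfLine = (∫ x, ‖f x‖ ^ 2 ∂halfLine)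
      + 2 * t * (∫ x, inner ℝ (f x) (e x) ∂halfLine) + t ^ 2 * ∫ x, ‖e x‖ ^ 2 ∂halfLine := by
  have h1 : Integrable (fun x => ‖f x‖ ^ 2) halfLine := hf.integrable_norm_pow (p := 2) (by norm_num)
  have h2 := (integrable_inner hf he).const_mul (2 * t)
  have h3 : Integrable (fun x => t ^ 2 * ‖e x‖ ^ 2) halfLine :=
    (he.integrable_norm_pow (p := 2) (by norm_num)).const_mul (t ^ 2)
  have h12 : Integrable (fun x => ‖f x‖ ^ 2 + 2 * t * inner ℝ (f x) (e x)) halfLine := h1.add h2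
  simp only [norm_add_mul_sq]
  rw [integral_add h12 h3, integral_add h1 h2, integral_const_mul, integral_const_mul]

theorem quadForm_add_mul (h : H1Pair u g) (h' : H1Pair w k) (t : ℝ) :
    quadForm α ω (fun x => u x + (t : ℂ) * w x) (fun x => g x + (t : ℂ) * k x) =
      quadForm α ω u g + 2 * t * bilinForm α ω u g w k + t ^ 2 * quadForm α ω w k := by
  simp only [quadForm, bilinForm]
  rw [integral_norm_add_mul_sq h.memLp h'.memLp,
    integral_norm_add_mul_sq h.memLp_deriv h'.memLp_deriv, norm_add_mul_sq]
  ring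

theorem integrable_pow_four_mul (h : H1Pair u g) {f : ℝ → ℝ} (hf : Integrable f halfLine) :
    Integrable (fun x => ‖u x‖ ^ 4 * f x) halfLine := by
  obtain ⟨C, hC0, hC⟩ := h.exists_bound
  refine hf.bdd_mul (c := C ^ 4) (h.continuous.norm.pow 4).aestronglyMeasurable ?_
  filter_upwards [ae_restrict_mem measurableSet_Ioi] with x hx
  rw [Real.norm_of_nonneg (by positivity)]
  gcongr
  exact hC x (le_of_lt hx)

theorem sextic_add_mul_ge (h : H1Pair u g) (h' : H1Pair w k) (t : ℝ) :
    sextic u + 6 * t * (∫ x, ‖u x‖ ^ 4 * inner ℝ (u x) (w x) ∂halfLine) ≤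
      sextic (fun x => u x + (t : ℂ) * w x) := by
  have h1 := h.integrable_pow_six
  have h2 := (h.integrable_pow_four_mul (integrable_inner h.memLp h'.memLp)).const_mul (6 * t)
  simp only [sextic]
  rw [← integral_const_mul, ← integral_add h1 h2]
  exact integral_mono (h1.add h2) (h.add (h'.const_mul t)).integrable_pow_six
    fun x => norm_pow_six_add_le _ _ _

/-- Minimality on the Nehari manifold, in scale invariant form. -/
theorem nehari_scale_invariant {N : ℝ} (hN : 0 ≤ N)
    (hmin : ∀ w k, H1Pair w k → 0 < sextic w → quadForm α ω w k = 3 / 16 * sextic w → N ≤ sextic w)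
    (h : H1Pair u g) (hq : 0 < quadForm α ω u g) (hs : 0 < sextic u) :
    (3 / 16) ^ 3 * N ^ 2 * sextic u ≤ quadForm α ω u g ^ 3 := by
  set Q := quadForm α ω u g
  set M := sextic u
  -- The squared amplitude that puts the multiple of u on the constraint: lQ = (3/16) l³ M.
  set l := √(16 * Q / (3 * M)) with hl
  have hlpos : 0 < l := Real.sqrt_pos.2 (by positivity)
  have hl2 : l ^ 2 = 16 * Q / (3 * M) := Real.sq_sqrt (by positivity)
  have hl2' : l ^ 2 * M = 16 / 3 * Q := by rw [hl2]; field_simp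
  let z : ℂ := (√l : ℝ)
  have hz2 : ‖z‖ ^ 2 = l := by
    rw [Complex.norm_real, Real.norm_of_nonneg (Real.sqrt_nonneg _), Real.sq_sqrt hlpos.le]
  have hz6 : ‖z‖ ^ 6 = l ^ 3 := by rw [← hz2]; ring
  have key := hmin _ _ (h.const_mul z)
  rw [sextic_const_mul, quadForm_const_mul, hz2, hz6] at key
  have h1 : N ≤ l ^ 3 * M := key (by positivity) (by
    linear_combination (-3 / 16 * l) * hl2')
  have h2 := pow_le_pow_left₀ hN h1 2
  have h3 : (l ^ 3 * M) ^ 2 * M = (16 / 3 * Q) ^ 3 := by rw [← hl2']; ring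
  have h4 := mul_le_mul_of_nonneg_right h2 hs.le
  rw [h3] at h4
  nlinarith

/-- The inequality `nehari_scale_invariant` holds along the whole line u + tw for small t, with
equality at t = 0, so no Lagrange multiplier is needed. -/
theorem euler_lagrange (h : H1Pair u g) (h0 : 0 < sextic u)
    (hK : quadForm α ω u g = 3 / 16 * sextic u)
    (hmin : ∀ w k, H1Pair w k → 0 < sextic w → quadForm α ω w k = 3 / 16 * sextic w →
      sextic u ≤ sextic w) (h' : H1Pair w k) :
    bilinForm α ω u g w k = 3 / 16 * ∫ x, ‖u x‖ ^ 4 * inner ℝ (u x) (w x) ∂halfLine := by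
  set D := ∫ x, ‖u x‖ ^ 4 * inner ℝ (u x) (w x) ∂halfLine
  set B := bilinForm α ω u g w k
  set N := sextic u
  set c := quadForm α ω w k
  -- Here q is the exact quadratic form along the line, whereas m is only the tangent lower bound
  -- for `sextic`. That is enough: q³ - (3/16)³N²m is nonnegative near 0 and vanishes at 0.
  let q : ℝ → ℝ := fun t => 3 / 16 * N + 2 * t * B + t ^ 2 * c
  let m : ℝ → ℝ := fun t => N + 6 * t * D
  have hq' : HasDerivAt q (2 * B) 0 := by
    have := ((((hasDerivAt_id (0 : ℝ)).const_mul 2).mul_const B).const_add (3 / 16 * N)).add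
      (((hasDerivAt_id (0 : ℝ)).pow 2).mul_const c)
    refine (this.congr_deriv ?_)
    simp
  have hm' : HasDerivAt m (6 * D) 0 := by
    have := (((hasDerivAt_id (0 : ℝ)).const_mul 6).mul_const D).const_add N
    refine (this.congr_deriv ?_)
    simp
  have hf := (hq'.pow 3).sub (hm'.const_mul ((3 / 16) ^ 3 * N ^ 2))
  have hlm : IsLocalMin (q ^ 3 - fun t => (3 / 16) ^ 3 * N ^ 2 * m t) 0 := by
    have e1 : ∀ᶠ t in 𝓝 (0 : ℝ), 0 < q t :=
      hq'.continuousAt.eventually (lt_mem_nhds (by simp [q]; exact h0))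
    have e2 : ∀ᶠ t in 𝓝 (0 : ℝ), 0 < m t :=
      hm'.continuousAt.eventually (lt_mem_nhds (by simp [m]; exact h0))
    filter_upwards [e1, e2] with t h1 h2
    have a1 : quadForm α ω (fun x => u x + (t : ℂ) * w x) (fun x => g x + (t : ℂ) * k x) = q t := by
      rw [h.quadForm_add_mul h', hK]
    have a2 := h.sextic_add_mul_ge h' t
    have a3 := nehari_scale_invariant h0.le hmin (h.add (h'.const_mul t)) (by rwa [a1])
      (h2.trans_le a2)
    rw [a1] at a3
    have a4 := mul_le_mul_of_nonneg_left a2 (by positivity : 0 ≤ (3 / 16 : ℝ) ^ 3 * N ^ 2)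
    simp only [Pi.sub_apply, Pi.pow_apply]
    have a5 : q 0 ^ 3 - (3 / 16) ^ 3 * N ^ 2 * m 0 = 0 := by simp only [q, m]; ring
    rw [a5]
    simp only [m]
    linarith
  have hzero := hlm.hasDerivAt_eq_zero hf
  have hq0 : q 0 = 3 / 16 * N := by simp [q]
  rw [hq0] at hzero
  have : N ^ 2 * (B - 3 / 16 * D) = 0 := by
    norm_num at hzero
    linear_combination (128 / 27) * hzero
  rcases mul_eq_zero.1 this with h1 | h1
  · exact absurd h1 (pow_ne_zero 2 h0.ne')
  · linarith

end H1Pair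

/-! ### From the weak equation to the Robin problem -/

/-- The nonlinearity of the stationary equation. -/
noncomputable def force (ω : ℝ) (z : ℂ) : ℂ := (ω - 3 / 16 * ‖z‖ ^ 4 : ℝ) • z

theorem continuous_force : Continuous (force ω) := by
  unfold force
  fun_prop

/-- The derivative predicted by the Euler–Lagrange equation and the Robin condition. -/
noncomputable def slope (α ω : ℝ) (u : ℝ → ℂ) (x : ℝ) : ℂ :=
  (α : ℝ) • u 0 + ∫ t in (0 : ℝ)..x, force ω (u t)

/-- A du Bois-Reymond argument: test the Euler–Lagrange identity with an antiderivative η of ψ, then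
integrate by parts so that everything is paired with ψ. -/
theorem deriv_ae_eq_slope {u g : ℝ → ℂ} (h : H1Pair u g) (h0 : 0 < sextic u)
    (hK : quadForm α ω u g = 3 / 16 * sextic u)
    (hmin : ∀ w k, H1Pair w k → 0 < sextic w → quadForm α ω w k = 3 / 16 * sextic w →
      sextic u ≤ sextic w) : g =ᵐ[halfLine] slope α ω u := by
  let f : ℝ → ℂ := fun x => force ω (u x)
  have hfc : Continuous f := continuous_force.comp h.continuous
  let F : ℝ → ℂ := fun x => ∫ t in (0 : ℝ)..x, f t
  have hFc : Continuous F := intervalIntegral.continuous_primitive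
    (fun a b => hfc.intervalIntegrable a b) 0
  have hsl : Continuous (slope α ω u) := continuous_const.add hFc
  have lg := memLp_two_locallyIntegrable h.memLp_deriv
  have main := ae_eq_zero_of_forall_test (lg.sub (μ := halfLine) hsl.locallyIntegrable)
    fun ψ hψ hψc hψs => ?_
  · exact main.mono fun x hx => sub_eq_zero.1 hx
  obtain ⟨ε, R, hε, hεR, hsub⟩ := exists_support_bounds hψc hψs
  have hR : 0 ≤ R := by linarith
  have zψ : ∀ x, R < x → ψ x = 0 := fun x hx =>
    image_eq_zero_of_notMem_tsupport fun hm => absurd (hsub hm).2 (not_le.2 hx)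
  set m : ℝ := ∫ t in (0 : ℝ)..R, ψ t with hm
  -- Normalized to vanish beyond R, not at 0: the value η(0) = -m carries the boundary term, and so
  -- the Robin condition.
  let η : ℝ → ℝ := fun x => (∫ t in (0 : ℝ)..x, ψ t) - m
  have hη' : ∀ x, HasDerivAt η (ψ x) x := fun x =>
    (intervalIntegral.integral_hasDerivAt_right (hψ.continuous.intervalIntegrable _ _)
      hψ.continuous.stronglyMeasurable.stronglyMeasurableAtFilter
      hψ.continuous.continuousAt).sub_const _
  have hηc : Continuous η := continuous_iff_continuousAt.2 fun x => (hη' x).continuousAt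
  have η0 : η 0 = -m := by simp [η]
  have zη : ∀ x, R ≤ x → η x = 0 := fun x hx => by
    simp only [η, hm]
    rw [intervalIntegral.integral_interval_sub_left (hψ.continuous.intervalIntegrable _ _)
      (hψ.continuous.intervalIntegrable _ _), intervalIntegral.integral_of_le hx]
    exact setIntegral_eq_zero_of_forall_eq_zero fun t ht => zψ t ht.1
  have hbdd : ∀ {e : ℝ → ℝ}, Continuous e → (∀ x, R < x → e x = 0) → MemLp e 2 halfLine := by
    intro e he hz
    rw [memLp_two_iff_integrable_sq he.aestronglyMeasurable]
    have h1 : IntegrableOn (fun x => e x ^ 2) (Ioc 0 R) volume :=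
      ((he.pow 2).integrableOn_Icc).mono_set Ioc_subset_Icc_self
    refine h1.of_forall_sdiff_eq_zero measurableSet_Ioi fun x hx => ?_
    rw [hz x (not_le.1 fun hxR => hx.2 ⟨hx.1, hxR⟩), zero_pow two_ne_zero]
  have hpair : H1Pair (fun x => (η x : ℂ)) (fun x => (ψ x : ℂ)) := by
    refine ⟨(hbdd hηc fun x hx => zη x hx.le).ofReal, (hbdd hψ.continuous zψ).ofReal,
      (Complex.continuous_ofReal.comp hψ.continuous).locallyIntegrable, fun x => ?_⟩
    rw [intervalIntegral.integral_ofReal]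
    simp only [η]
    push_cast
    simp
    ring
  have hηint : ∀ {e : ℝ → ℂ}, Continuous e → Integrable (fun x => η x • e x) halfLine := by
    intro e he
    have h1 : IntegrableOn (fun x => η x • e x) (Ioc 0 R) volume :=
      ((hηc.smul he).integrableOn_Icc).mono_set Ioc_subset_Icc_self
    refine h1.of_forall_sdiff_eq_zero measurableSet_Ioi fun x hx => ?_
    rw [zη x (le_of_lt (not_le.1 fun hxR => hx.2 ⟨hx.1, hxR⟩)), zero_smul]
  have iψg : Integrable (fun x => ψ x • g x) halfLine :=
    lg.integrable_smul_left_of_hasCompactSupport hψ.continuous hψc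
  have hEL : (∫ x, ψ x • g x ∂halfLine) + (∫ x, η x • f x ∂halfLine) + (α * η 0) • u 0 = 0 := by
    -- The Euler–Lagrange identity is a real scalar one; testing with zη for every complex z
    -- recovers the vector identity.
    refine ext_inner_left ℝ fun z => ?_
    have e := h.euler_lagrange h0 hK hmin (hpair.const_mul z)
    have hin : ∀ (a : ℂ) (r : ℝ), inner ℝ a (z * (r : ℂ)) = inner ℝ z (r • a) := fun a r => by
      rw [mul_comm, ← Complex.real_smul, real_inner_smul_right, real_inner_smul_right,
        real_inner_comm]
    have hf : ∀ x, η x • f x = ω • (η x • u x) - (3 / 16 : ℝ) • (η x • (‖u x‖ ^ 4 • u x)) :=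
      fun x => by
        simp only [f, force, smul_smul, ← sub_smul]
        congr 1
        ring
    have i1 := hηint h.continuous
    have i2 : Integrable (fun x => η x • (‖u x‖ ^ 4 • u x)) halfLine :=
      hηint ((h.continuous.norm.pow 4).smul h.continuous)
    have i1' : Integrable (fun x => ω • (η x • u x)) halfLine := i1.smul ω
    have i2' : Integrable (fun x => (3 / 16 : ℝ) • (η x • (‖u x‖ ^ 4 • u x))) halfLine :=
      i2.smul (3 / 16 : ℝ)
    have hD : ∀ x, ‖u x‖ ^ 4 * inner ℝ (u x) (z * (η x : ℂ)) =
        inner ℝ z (η x • (‖u x‖ ^ 4 • u x)) := fun x => by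
      rw [hin, smul_comm (η x), real_inner_smul_right _ _ (‖u x‖ ^ 4)]
    simp only [bilinForm, hD] at e
    simp only [hin] at e
    rw [integral_inner iψg, integral_inner i1, integral_inner i2] at e
    simp only [hf]
    rw [integral_sub i1' i2', integral_smul, integral_smul, inner_add_right, inner_add_right,
      inner_sub_right, real_inner_smul_right, real_inner_smul_right, inner_zero_right, mul_smul,
      real_inner_smul_right]
    linarith
  have hparts := integral_smul_add_smul hψ.continuous hη' hfc.locallyIntegrable
    (u := F) (by simp [F]) 0 R
  have iF : IntervalIntegrable (fun x => ψ x • F x) volume 0 R :=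
    (hψ.continuous.smul hFc).intervalIntegrable _ _
  have iηf : IntervalIntegrable (fun x => η x • f x) volume 0 R :=
    (hηc.smul hfc).intervalIntegrable _ _
  have ic : IntervalIntegrable (fun x => ψ x • ((α : ℝ) • u 0)) volume 0 R :=
    (hψ.continuous.smul continuous_const).intervalIntegrable _ _
  have hF0 : F 0 = 0 := by simp [F]
  rw [zη R le_rfl, hF0, zero_smul, smul_zero, sub_zero, intervalIntegral.integral_add iF iηf] at hparts
  rw [setIntegral_Ioi_eq_intervalIntegral (f := fun x => η x • f x) hR
    (fun x hx => by rw [zη x hx.le, zero_smul]), eq_neg_of_add_eq_zero_right hparts, η0] at hEL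
  have e1 : ∫ x, ψ x • slope α ω u x ∂halfLine =
      m • ((α : ℝ) • u 0) + ∫ x in (0 : ℝ)..R, ψ x • F x := by
    rw [setIntegral_Ioi_eq_intervalIntegral hR (fun x hx => by rw [zψ x hx, zero_smul])]
    have : ∀ x, ψ x • slope α ω u x = ψ x • ((α : ℝ) • u 0) + ψ x • F x := fun x => smul_add _ _ _
    simp only [this]
    rw [intervalIntegral.integral_add ic iF, intervalIntegral.integral_smul_const]
  simp only [Pi.sub_apply, smul_sub]
  rw [integral_sub iψg ((hsl.locallyIntegrable (μ := halfLine)).integrable_smul_left_of_hasCompactSupport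
    hψ.continuous hψc), e1, ← hEL, smul_smul]
  rw [mul_neg, neg_smul, mul_comm α m]
  abel

/-! ### Uniqueness for the stationary equation -/

theorem contDiff_force : ContDiff ℝ 1 (force ω) := by
  have h : force ω = fun z => (ω - 3 / 16 * (‖z‖ ^ 2) ^ 2 : ℝ) • z := by
    funext z
    rw [force]
    congr 2
    ring
  rw [h]
  exact (contDiff_const.sub (contDiff_const.mul ((contDiff_norm_sq ℝ).pow 2))).smul contDiff_id

/-- Uniqueness for the initial value problem of the stationary equation. -/
theorem eqOn_of_stationary {u p w q : ℝ → ℂ} (huc : ContinuousOn u (Ici 0))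
    (hpc : ContinuousOn p (Ici 0)) (hwc : ContinuousOn w (Ici 0)) (hqc : ContinuousOn q (Ici 0))
    (hu : ∀ x, 0 ≤ x → HasDerivWithinAt u (p x) (Ici x) x)
    (hp : ∀ x, 0 ≤ x → HasDerivWithinAt p (force ω (u x)) (Ici x) x)
    (hw : ∀ x, 0 ≤ x → HasDerivWithinAt w (q x) (Ici x) x)
    (hq : ∀ x, 0 ≤ x → HasDerivWithinAt q (force ω (w x)) (Ici x) x)
    (h0 : u 0 = w 0) (h1 : p 0 = q 0) : EqOn u w (Ici 0) := by
  intro X hX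
  have hsub : Icc 0 X ⊆ Ici (0 : ℝ) := Icc_subset_Ici_self
  have hc1 : ContinuousOn (fun x => (u x, p x)) (Icc 0 X) := (huc.prodMk hpc).mono hsub
  have hc2 : ContinuousOn (fun x => (w x, q x)) (Icc 0 X) := (hwc.prodMk hqc).mono hsub
  obtain ⟨C₁, hC₁⟩ := isCompact_Icc.exists_bound_of_continuousOn hc1
  obtain ⟨C₂, hC₂⟩ := isCompact_Icc.exists_bound_of_continuousOn hc2
  let V : ℂ × ℂ → ℂ × ℂ := fun y => (y.2, force ω y.1)
  have hV : ContDiff ℝ 1 V := contDiff_snd.prodMk (contDiff_force.comp contDiff_fst)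
  -- The quintic field is only locally Lipschitz, but on [0, X] both trajectories stay in one closed
  -- ball.
  obtain ⟨L, hL⟩ := hV.contDiffOn.exists_lipschitzOnWith one_ne_zero
    (convex_closedBall (0 : ℂ × ℂ) (max C₁ C₂)) (isCompact_closedBall _ _)
  have := ODE_solution_unique_of_mem_Icc_right (v := fun _ => V)
    (s := fun _ => Metric.closedBall 0 (max C₁ C₂)) (fun _ _ => hL) hc1
    (fun x hx => (hu x hx.1).prodMk (hp x hx.1))
    (fun x hx => by
      simpa using (Or.inl (hC₁ x (Ico_subset_Icc_self hx)) : _ ∨ ‖(u x, p x)‖ ≤ C₂))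
    hc2 (fun x hx => (hw x hx.1).prodMk (hq x hx.1))
    (fun x hx => by
      simpa using (Or.inr (hC₂ x (Ico_subset_Icc_self hx)) : ‖(w x, q x)‖ ≤ C₁ ∨ _))
    (Prod.ext h0 h1) (right_mem_Icc.2 hX)
  exact congrArg Prod.fst this

theorem hasDerivAt_slope {u : ℝ → ℂ} (hu : Continuous u) (x : ℝ) :
    HasDerivAt (slope α ω u) (force ω (u x)) x :=
  (intervalIntegral.integral_hasDerivAt_right
    ((continuous_force.comp hu).intervalIntegrable _ _)
    (continuous_force.comp hu).stronglyMeasurable.stronglyMeasurableAtFilter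
    (continuous_force.comp hu).continuousAt).const_add _

/-- Almost everywhere agreement with p is known only on (0, ∞), so the derivative is taken from the
right in order to include x = 0. -/
theorem H1Pair.hasDerivWithinAt_of_ae_eq {u g p : ℝ → ℂ} (h : H1Pair u g) (hp : Continuous p)
    (hgp : g =ᵐ[halfLine] p) {x : ℝ} (hx : 0 ≤ x) : HasDerivWithinAt u (p x) (Ici x) x := by
  have h1 : ∀ y, 0 ≤ y → u y = u 0 + ∫ t in (0 : ℝ)..y, p t := fun y hy => by
    rw [h.eq_integral y]
    congr 1
    refine intervalIntegral.integral_congr_ae ?_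
    filter_upwards [(ae_restrict_iff' measurableSet_Ioi).1 hgp] with t ht hty
    rw [uIoc_of_le hy] at hty
    exact ht hty.1
  have h2 : HasDerivAt (fun y => u 0 + ∫ t in (0 : ℝ)..y, p t) (p x) x :=
    (intervalIntegral.integral_hasDerivAt_right (hp.intervalIntegrable _ _)
      hp.stronglyMeasurable.stronglyMeasurableAtFilter hp.continuousAt).const_add _
  exact h2.hasDerivWithinAt.congr (fun y hy => h1 y (hx.trans hy)) (h1 x hx)

/-- The conserved quantity of a square integrable solution vanishes. -/
theorem first_integral_eq_zero {u g p : ℝ → ℂ} (h : H1Pair u g) (hp : Continuous p)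
    (hgp : g =ᵐ[halfLine] p)
    (hp' : ∀ x, 0 ≤ x → HasDerivWithinAt p (force ω (u x)) (Ici x) x) :
    ‖p 0‖ ^ 2 - ω * ‖u 0‖ ^ 2 + (‖u 0‖ ^ 2) ^ 3 / 16 = 0 := by
  let I : ℝ → ℝ := fun x => ‖p x‖ ^ 2 - ω * ‖u x‖ ^ 2 + (‖u x‖ ^ 2) ^ 3 / 16
  have hIc : Continuous I := by
    have := h.continuous
    fun_prop
  have hI' : ∀ x, 0 ≤ x → HasDerivWithinAt I 0 (Ici x) x := fun x hx => by
    have d1 := (hp' x hx).norm_sq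
    have d2 := (h.hasDerivWithinAt_of_ae_eq hp hgp hx).norm_sq
    refine ((d1.sub (d2.const_mul ω)).add ((d2.pow 3).div_const 16)).congr_deriv ?_
    rw [force, real_inner_smul_right, real_inner_comm (u x) (p x)]
    push_cast
    ring
  have hconst : ∀ x, 0 ≤ x → I x = I 0 := fun x hx =>
    constant_of_has_deriv_right_zero hIc.continuousOn (fun y hy => hI' y hy.1) x
      (right_mem_Icc.2 hx)
  have hint : Integrable (fun x => ‖g x‖ ^ 2 - ω * ‖u x‖ ^ 2 + ‖u x‖ ^ 6 / 16) halfLine :=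
    (h.integrable_deriv_sq.sub (h.integrable_sq.const_mul ω)).add (h.integrable_pow_six.div_const 16)
  -- A constant that is integrable over a half line of infinite measure must be zero.
  have hI0 : Integrable (fun _ => I 0) halfLine := by
    refine hint.congr ?_
    filter_upwards [hgp, ae_restrict_mem measurableSet_Ioi] with x hx hx0
    rw [← hconst x (le_of_lt hx0), hx]
    simp only [I]
    ring
  rw [integrable_const_iff, isFiniteMeasure_iff, Measure.restrict_apply_univ, Real.volume_Ioi] at hI0
  exact hI0.resolve_right (lt_irrefl _)

/-- A least-norm element of the Nehari manifold is the profile up to a phase. -/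
theorem exists_phase (hω : α ^ 2 < ω) {u g : ℝ → ℂ} (h : H1Pair u g) (h0 : 0 < sextic u)
    (hK : quadForm α ω u g = 3 / 16 * sextic u)
    (hmin : ∀ w k, H1Pair w k → 0 < sextic w → quadForm α ω w k = 3 / 16 * sextic w →
      sextic u ≤ sextic w) :
    ∃ θ : ℝ, EqOn u (fun x => Complex.exp (θ * Complex.I) * profileC α ω x) (Ici 0) := by
  have hgp := deriv_ae_eq_slope h h0 hK hmin
  have hpd := fun x => hasDerivAt_slope (α := α) (ω := ω) h.continuous x
  have hpc : Continuous (slope α ω u) := continuous_iff_continuousAt.2 fun x => (hpd x).continuousAt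
  have hp' : ∀ x, 0 ≤ x → HasDerivWithinAt (slope α ω u) (force ω (u x)) (Ici x) x :=
    fun x _ => (hpd x).hasDerivWithinAt
  have hu' : ∀ x, 0 ≤ x → HasDerivWithinAt u (slope α ω u x) (Ici x) x :=
    fun x hx => h.hasDerivWithinAt_of_ae_eq hpc hgp hx
  have hp0 : slope α ω u 0 = (α : ℂ) * u 0 := by simp [slope]
  have hI := first_integral_eq_zero h hpc hgp hp'
  rw [hp0, norm_mul, Complex.norm_real, mul_pow, Real.norm_eq_abs, sq_abs] at hI
  -- If u(0) = 0, the Robin condition gives u'(0) = 0 as well, and uniqueness makes u vanish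
  -- identically.
  have hn : ‖u 0‖ ≠ 0 := fun hn => h0.ne' <| by
    have hu0 : u 0 = 0 := norm_eq_zero.1 hn
    have hz := eqOn_of_stationary (w := fun _ => 0) (q := fun _ => 0) h.continuous.continuousOn
      hpc.continuousOn continuousOn_const continuousOn_const hu' hp'
      (fun x _ => hasDerivWithinAt_const _ _ _)
      (fun x _ => by simpa [force] using hasDerivWithinAt_const x (Ici x) (0 : ℂ)) hu0
      (by rw [hp0, hu0, mul_zero])
    have : sextic u = ∫ x, (0 : ℝ) ∂halfLine :=
      setIntegral_congr_fun measurableSet_Ioi fun x hx => by simp [hz (mem_Ici_of_Ioi hx)]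
    rw [this, integral_zero]
  have hnorm : ‖u 0‖ = smoothProfile α ω 0 := by
    -- The vanishing first integral with u'(0) = αu(0), divided by |u(0)|², gives |u(0)|⁴ = 16(ω -
    -- α²).
    have h1 : (‖u 0‖ ^ 2) ^ 2 = (smoothProfile α ω 0 ^ 2) ^ 2 := by
      rw [smoothProfile_zero_sq hω]
      have h2 : ‖u 0‖ ^ 2 * (α ^ 2 - ω + (‖u 0‖ ^ 2) ^ 2 / 16) = 0 := by linear_combination hI
      rcases mul_eq_zero.1 h2 with h3 | h3
      · exact absurd h3 (pow_ne_zero 2 hn)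
      · linarith
    rw [← pow_mul, ← pow_mul] at h1
    exact (pow_left_inj₀ (norm_nonneg _) (smoothProfile_pos hω 0).le (by norm_num)).1 h1
  refine ⟨(u 0).arg, ?_⟩
  set z := Complex.exp ((u 0).arg * Complex.I) with hz
  have hu0 : u 0 = z * profileC α ω 0 := by
    rw [profileC, ← hnorm, mul_comm, hz, Complex.norm_mul_exp_arg_mul_I]
  have hw := (profileC_pair hω (α := α)).const_mul z
  have d1 : ∀ x, HasDerivAt (fun x => z * profileC α ω x) (z * profileDerivC α ω x) x := fun x =>
    ((hasDerivAt_smoothProfile hω x).ofReal_comp).const_mul z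
  have d2 : ∀ x, HasDerivAt (fun x => z * profileDerivC α ω x) (force ω (z * profileC α ω x)) x :=
    fun x => by
      refine (((hasDerivAt_deriv_smoothProfile hω x).ofReal_comp).const_mul z).congr_deriv ?_
      have hz1 : ‖z‖ = 1 := Complex.norm_exp_ofReal_mul_I _
      rw [force, norm_mul, hz1, one_mul, norm_profileC hω, Complex.real_smul, profileC]
      push_cast
      ring
  refine eqOn_of_stationary h.continuous.continuousOn hpc.continuousOn hw.continuous.continuousOn
    (continuous_iff_continuousAt.2 fun x => (d2 x).continuousAt).continuousOn hu' hp'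
    (fun x _ => (d1 x).hasDerivWithinAt) (fun x _ => (d2 x).hasDerivWithinAt) hu0 ?_
  rw [hp0, hu0, profileDerivC, profileTanh_zero hω, profileC]
  push_cast
  ring

end RobinDNLS

theorem proposition1p2 (α ω : ℝ) (hω : α ^ 2 < ω) (v : ℝ → ℂ) :
    RobinDNLS.IsMinimizer α ω v ↔
      ∃ θ : ℝ, v =ᵐ[RobinDNLS.halfLine]
        fun x => Complex.exp (θ * Complex.I) * (RobinDNLS.profile α ω x : ℂ) := by
  have hprof : ∀ θ : ℝ, (fun x => Complex.exp (θ * Complex.I) * (RobinDNLS.profile α ω x : ℂ))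
      =ᵐ[RobinDNLS.halfLine] fun x => Complex.exp (θ * Complex.I) * RobinDNLS.profileC α ω x :=
    fun θ => by
      filter_upwards [ae_restrict_mem measurableSet_Ioi] with x hx
      rw [RobinDNLS.profile_eq_smoothProfile hω (le_of_lt hx), RobinDNLS.profileC]
  constructor
  · intro hm
    obtain ⟨u, g, hp, hv⟩ := hm.1.1.exists_pair
    obtain ⟨⟨h0, hK⟩, hmin⟩ := (RobinDNLS.isMinimizer_iff hp hv).1 hm
    obtain ⟨θ, hθ⟩ := RobinDNLS.exists_phase hω hp h0 hK hmin
    refine ⟨θ, hv.trans (Filter.EventuallyEq.trans ?_ (hprof θ).symm)⟩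
    filter_upwards [ae_restrict_mem measurableSet_Ioi] with x hx using hθ (mem_Ici_of_Ioi hx)
  · rintro ⟨θ, hθ⟩
    have hz : ‖Complex.exp (θ * Complex.I)‖ = 1 := Complex.norm_exp_ofReal_mul_I θ
    have hp := (RobinDNLS.profileC_pair hω (α := α)).const_mul (Complex.exp (θ * Complex.I))
    rw [RobinDNLS.isMinimizer_iff hp (hθ.trans (hprof θ)), RobinDNLS.H1Pair.sextic_const_mul,
      RobinDNLS.H1Pair.quadForm_const_mul, hz, one_pow, one_pow, one_mul, one_mul]
    exact ⟨⟨RobinDNLS.sextic_profile_pos hω, RobinDNLS.quadForm_profile hω⟩,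
      fun w k hw h1 h2 => RobinDNLS.sextic_profile_le hω hw h1 h2⟩
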